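/- Let $G$ be a finite group. A $G$-Tambara functor $T$ assigns to every finite $G$-set $X$ a commutative ring $T(X)$, taking disjoint unions to products, together with restrictions (ring homomorphisms), transfers (additive maps) and norms (multiplicative maps) along all maps of finite $G$-sets; these are functorial and satisfy base change for cartesian squares and the distributive law for exponential diagrams. A morphism is a family of ring homomorphisms commuting with restrictions, transfers and norms. An ideal $I$ of $T$ is a collection of ideals $I(G/H)\subseteq T(G/H)$, $H\le G$, closed under restriction, transfer, norm and conjugation; ideals are ordered by levelwise inclusion. The product $IJ$ is the ideal generated by the $I(G/H)J(G/H)$, and an ideal $\mathfrak p\neq T$ is prime if $IJ\subseteq \mathfrak p$ implies $I\subseteq\mathfrak p$ or $J\subseteq\mathfrak p$ for all ideals $I,J$. The Nakaoka spectrum $\operatorname{Spec}(T)$ is the set of prime ideals of $T$ with the topology whose closed sets are the sets $V(I)=\{\mathfrak p : I\subseteq\mathfrak p\}$. **Theorem.** Let $f\colon S\to T$ be a morphism of $G$-Tambara functors that is levelwise integral, i.e. $S(G/H)\to T(G/H)$ is an integral homomorphism of commutative rings for every $H\le G$. Then: 1. (Going up) For all prime ideals $\mathfrak p_0\subsetneq\mathfrak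 p_1$ of $S$ and every prime ideal $\mathfrak q_0$ of $T$ with $f^{-1}(\mathfrak q_0)=\mathfrak p_0$ there is a prime ideal $\mathfrak q_1$ of $T$ with $\mathfrak q_0\subsetneq\mathfrak q_1$ and $f^{-1}(\mathfrak q_1)=\mathfrak p_1$. 2. (Lying over) Taking inverse images of prime ideals gives a well-defined continuous map $f^*\colon\operatorname{Spec}(T)\to\operatorname{Spec}(S)$, $\mathfrak q\mapsto f^{-1}(\mathfrak q)$. It is surjective if $f$ is levelwise injective, i.e. if $S(G/H)\to T(G/H)$ is injective for every $H\le G$. More generally, it is surjective if $\ker(f)\subseteq\bigcap_{\mathfrak p\in\operatorname{Spec}(S)}\mathfrak p$. -/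

import Mathlib

universe u v w

/-- A finite `G`-set. -/
structure FinGSet (G : Type u) [Group G] where
  carrier : Type u
  [action : MulAction G carrier]
  [finite : Finite carrier]

namespace FinGSet

instance {G : Type u} [Group G] : CoeSort (FinGSet G) (Type u) := ⟨FinGSet.carrier⟩

attribute [instance] FinGSet.action FinGSet.finite

variable {G : Type u} [Group G]

/-- Disjoint union of finite `G`-sets. -/
def sum (X Y : FinGSet G) : FinGSet G := ⟨X ⊕ Y⟩

/-- The left inclusion into the disjoint union. -/
def inl (X Y : FinGSet G) : X →[G] X.sum Y where
  toFun := Sum.inl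
  map_smul' _ _ := rfl

/-- The right inclusion into the disjoint union. -/
def inr (X Y : FinGSet G) : Y →[G] X.sum Y where
  toFun := Sum.inr
  map_smul' _ _ := rfl

/-- The commutative square
```
  W --a--> X
  |b       |f
  v        v
  Y --g--> Z
```
of finite `G`-sets is cartesian. -/
def IsCartesian {W X Y Z : FinGSet G} (a : W →[G] X) (b : W →[G] Y)
    (f : X →[G] Z) (g : Y →[G] Z) : Prop :=
  (∀ t, f (a t) = g (b t)) ∧ ∀ x y, f x = g y → ∃! t, a t = x ∧ b t = y

/-- The diagram
```
  X <--h-- A <--e-- E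
  |f                |p
  v                 v
  Y <-------q------ B
```
of finite `G`-sets is an exponential diagram: the outer rectangle (with top edge `h ∘ e`) is
cartesian, and `b ↦ (q b, e restricted to the fibre of p over b)` identifies `B` with the set of
pairs `(y, σ)`, where `y ∈ Y` and `σ : f⁻¹(y) → A` is a section of `h` over `f⁻¹(y)`.
In other words `B ≅ Π_f A` and `E ≅ X ×_Y Π_f A`, with `e` the evaluation map. -/
def IsExponential {A X Y B E : FinGSet G} (h : A →[G] X) (f : X →[G] Y)
    (e : E →[G] A) (p : E →[G] B) (q : B →[G] Y) : Prop :=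
  IsCartesian (h.comp e) p f q ∧
    ∀ (y : Y) (σ : {x : X // f x = y} → A), (∀ x, h (σ x) = x) →
      ∃! b : B, q b = y ∧ ∀ (t : E) (ht : f (h (e t)) = y), p t = b → e t = σ ⟨h (e t), ht⟩

end FinGSet

open FinGSet in
/-- A `G`-Tambara functor: commutative rings `T(X)` for all finite `G`-sets `X`, with restrictions
(ring homomorphisms), transfers (additive) and norms (multiplicative) along all `G`-maps, each of
them functorial, turning disjoint unions into products, satisfying base change for cartesian
squares and the distributive law for exponential diagrams. -/
structure TambaraFunctor (G : Type u) [Group G] where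
  obj : FinGSet G → Type v
  [ring : ∀ X, CommRing (obj X)]
  res : ∀ {X Y : FinGSet G}, (X →[G] Y) → (obj Y →+* obj X)
  tr : ∀ {X Y : FinGSet G}, (X →[G] Y) → (obj X →+ obj Y)
  nm : ∀ {X Y : FinGSet G}, (X →[G] Y) → (obj X →* obj Y)
  res_id : ∀ (X : FinGSet G) (t : obj X), res (MulActionHom.id G (X := X)) t = t
  tr_id : ∀ (X : FinGSet G) (t : obj X), tr (MulActionHom.id G (X := X)) t = t
  nm_id : ∀ (X : FinGSet G) (t : obj X), nm (MulActionHom.id G (X := X)) t = t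
  res_comp : ∀ {X Y Z : FinGSet G} (g : Y →[G] Z) (f : X →[G] Y) (t : obj Z),
    res (g.comp f) t = res f (res g t)
  tr_comp : ∀ {X Y Z : FinGSet G} (g : Y →[G] Z) (f : X →[G] Y) (t : obj X),
    tr (g.comp f) t = tr g (tr f t)
  nm_comp : ∀ {X Y Z : FinGSet G} (g : Y →[G] Z) (f : X →[G] Y) (t : obj X),
    nm (g.comp f) t = nm g (nm f t)
  obj_empty : ∀ (X : FinGSet G), IsEmpty X → Subsingleton (obj X)
  obj_sum : ∀ (X Y : FinGSet G),
    Function.Bijective fun t : obj (X.sum Y) => (res (inl X Y) t, res (inr X Y) t)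
  res_tr : ∀ {W X Y Z : FinGSet G} (a : W →[G] X) (b : W →[G] Y) (f : X →[G] Z) (g : Y →[G] Z),
    IsCartesian a b f g → ∀ t : obj X, res g (tr f t) = tr b (res a t)
  res_nm : ∀ {W X Y Z : FinGSet G} (a : W →[G] X) (b : W →[G] Y) (f : X →[G] Z) (g : Y →[G] Z),
    IsCartesian a b f g → ∀ t : obj X, res g (nm f t) = nm b (res a t)
  nm_tr : ∀ {A X Y B E : FinGSet G} (h : A →[G] X) (f : X →[G] Y)
    (e : E →[G] A) (p : E →[G] B) (q : B →[G] Y),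
    IsExponential h f e p q → ∀ t : obj A, nm f (tr h t) = tr q (nm p (res e t))

attribute [instance] TambaraFunctor.ring

/-- A morphism of Tambara functors: ring homomorphisms `S(X) → T(X)` for all finite `G`-sets `X`,
commuting with restrictions, transfers and norms. -/
structure TambaraHom {G : Type u} [Group G] (S : TambaraFunctor.{u, v} G)
    (T : TambaraFunctor.{u, w} G) where
  app : ∀ X : FinGSet G, S.obj X →+* T.obj X
  app_res : ∀ {X Y : FinGSet G} (f : X →[G] Y) (s : S.obj Y),
    app X (S.res f s) = T.res f (app Y s)
  app_tr : ∀ {X Y : FinGSet G} (f : X →[G] Y) (s : S.obj X),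
    app Y (S.tr f s) = T.tr f (app X s)
  app_nm : ∀ {X Y : FinGSet G} (f : X →[G] Y) (s : S.obj X),
    app Y (S.nm f s) = T.nm f (app X s)

section Orbits

variable {G : Type u} [Group G]

/-- The transitive `G`-set `G/H`. -/
def FinGSet.orbit [Finite G] (H : Subgroup G) : FinGSet G := ⟨G ⧸ H⟩

/-- The projection `q_K^H : G/K → G/H`, `xK ↦ xH`, for `K ≤ H`. -/
def orbitProj [Finite G] {K H : Subgroup G} (h : K ≤ H) :
    FinGSet.orbit K →[G] FinGSet.orbit H where
  toFun := Subgroup.quotientMapOfLE h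
  map_smul' g x := by
    induction x using QuotientGroup.induction_on with
    | H x => rfl

/-- The conjugate subgroup `g H g⁻¹`. -/
def conjSubgroup (H : Subgroup G) (g : G) : Subgroup G :=
  H.map (MulAut.conj g).toMonoidHom

/-- The bijection `c_g : G/gHg⁻¹ → G/H`, `x gHg⁻¹ ↦ xgH`. -/
def orbitConj [Finite G] (H : Subgroup G) (g : G) :
    FinGSet.orbit (conjSubgroup H g) →[G] FinGSet.orbit H where
  toFun := Quotient.map' (fun x => x * g) (by
    intro x y hxy
    rw [QuotientGroup.leftRel_apply] at hxy ⊢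
    obtain ⟨k, hk, hk'⟩ := hxy
    have : (x * g)⁻¹ * (y * g) = k := by
      simp only [MulEquiv.coe_toMonoidHom, MulAut.conj_apply] at hk'
      rw [mul_inv_rev, mul_assoc, ← mul_assoc x⁻¹, ← hk']
      group
    rw [this]
    exact hk)
  map_smul' a x := by
    induction x using QuotientGroup.induction_on with
    | H x => exact congrArg (QuotientGroup.mk (s := H)) (mul_assoc a x g)

end Orbits

section Ideals

variable {G : Type u} [Group G] [Finite G]

/-- The level `T(G/H)`. -/
abbrev TambaraFunctor.level (T : TambaraFunctor.{u, v} G) (H : Subgroup G) : Type v :=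
  T.obj (FinGSet.orbit H)

/-- An ideal of a Tambara functor: ideals `I(G/H)` of the rings `T(G/H)`, closed under transfer,
norm, restriction and conjugation. -/
@[ext]
structure TambaraIdeal (T : TambaraFunctor.{u, v} G) where
  lev : ∀ H : Subgroup G, Ideal (T.level H)
  tr_mem : ∀ {K H : Subgroup G} (h : K ≤ H) {x : T.level K},
    x ∈ lev K → T.tr (orbitProj h) x ∈ lev H
  nm_mem : ∀ {K H : Subgroup G} (h : K ≤ H) {x : T.level K},
    x ∈ lev K → T.nm (orbitProj h) x ∈ lev H
  res_mem : ∀ {K H : Subgroup G} (h : K ≤ H) {x : T.level H},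
    x ∈ lev H → T.res (orbitProj h) x ∈ lev K
  conj_mem : ∀ (H : Subgroup G) (g : G) {x : T.level H},
    x ∈ lev H → T.res (orbitConj H g) x ∈ lev (conjSubgroup H g)

namespace TambaraIdeal

variable {S : TambaraFunctor.{u, w} G} {T : TambaraFunctor.{u, v} G}

/-- Levelwise inclusion. -/
instance : PartialOrder (TambaraIdeal T) where
  le I J := ∀ H, I.lev H ≤ J.lev H
  le_refl _ _ := le_rfl
  le_trans _ _ _ h h' H := (h H).trans (h' H)
  le_antisymm _ _ h h' := TambaraIdeal.ext (funext fun H => le_antisymm (h H) (h' H))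

/-- The unit ideal `T`. -/
instance : Top (TambaraIdeal T) where
  top :=
    { lev := fun _ => ⊤
      tr_mem := fun _ _ _ => Submodule.mem_top
      nm_mem := fun _ _ _ => Submodule.mem_top
      res_mem := fun _ _ _ => Submodule.mem_top
      conj_mem := fun _ _ _ _ => Submodule.mem_top }

/-- The ideal generated by a levelwise collection of subsets: the levelwise intersection of all
ideals that contain it. -/
def span (s : ∀ H : Subgroup G, Set (T.level H)) : TambaraIdeal T where
  lev H := ⨅ I : {I : TambaraIdeal T // ∀ H, s H ⊆ I.lev H}, I.1.lev H
  tr_mem h _ hx := by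
    rw [Submodule.mem_iInf] at hx ⊢
    exact fun I => I.1.tr_mem h (hx I)
  nm_mem h _ hx := by
    rw [Submodule.mem_iInf] at hx ⊢
    exact fun I => I.1.nm_mem h (hx I)
  res_mem h _ hx := by
    rw [Submodule.mem_iInf] at hx ⊢
    exact fun I => I.1.res_mem h (hx I)
  conj_mem H g _ hx := by
    rw [Submodule.mem_iInf] at hx ⊢
    exact fun I => I.1.conj_mem H g (hx I)

theorem span_le {s : ∀ H : Subgroup G, Set (T.level H)} {J : TambaraIdeal T} :
    span s ≤ J ↔ ∀ H, s H ⊆ J.lev H := by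
  constructor
  · intro h H x hx
    exact h H (Submodule.mem_iInf _ |>.2 fun I => I.2 H hx)
  · intro h H x hx
    exact (Submodule.mem_iInf _ |>.1 hx) ⟨J, h⟩

/-- The product of two ideals: the ideal generated by the `I(G/H) J(G/H)`. -/
def mul (I J : TambaraIdeal T) : TambaraIdeal T :=
  span fun H => (I.lev H * J.lev H : Ideal (T.level H))

/-- Prime ideals: proper ideals `P` such that `I J ⊆ P` implies `I ⊆ P` or `J ⊆ P`. -/
def IsPrime (P : TambaraIdeal T) : Prop :=
  P ≠ ⊤ ∧ ∀ I J : TambaraIdeal T, I.mul J ≤ P → I ≤ P ∨ J ≤ P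

/-- The inverse image `f⁻¹(I)` of an ideal. -/
def comap (f : TambaraHom S T) (I : TambaraIdeal T) : TambaraIdeal S where
  lev H := (I.lev H).comap (f.app _)
  tr_mem h _ hx := by
    rw [Ideal.mem_comap] at hx ⊢
    rw [f.app_tr]
    exact I.tr_mem h hx
  nm_mem h _ hx := by
    rw [Ideal.mem_comap] at hx ⊢
    rw [f.app_nm]
    exact I.nm_mem h hx
  res_mem h _ hx := by
    rw [Ideal.mem_comap] at hx ⊢
    rw [f.app_res]
    exact I.res_mem h hx
  conj_mem H g _ hx := by
    rw [Ideal.mem_comap] at hx ⊢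
    rw [f.app_res]
    exact I.conj_mem H g hx

end TambaraIdeal

/-- The points of the Nakaoka spectrum: the prime ideals of `T`. -/
@[ext]
structure NakaokaSpec (T : TambaraFunctor.{u, v} G) where
  ideal : TambaraIdeal T
  isPrime : ideal.IsPrime

namespace NakaokaSpec

variable {T : TambaraFunctor.{u, v} G}

/-- `V(I)`, the set of primes containing `I`. -/
def zeroLocus (I : TambaraIdeal T) : Set (NakaokaSpec T) := {p | I ≤ p.ideal}

/-- The Zariski topology: the closed sets are the `V(I)`. -/
instance : TopologicalSpace (NakaokaSpec T) :=
  TopologicalSpace.ofClosed (Set.range zeroLocus)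
    (by
      refine ⟨⊤, Set.eq_empty_of_forall_notMem fun p hp => p.isPrime.1 ?_⟩
      exact le_antisymm (fun _ => le_top) hp)
    (by
      intro A hA
      refine ⟨TambaraIdeal.span fun H => ⋃ I ∈ zeroLocus ⁻¹' A, (I.lev H : Set (T.level H)), ?_⟩
      ext p
      simp only [zeroLocus, Set.mem_ofPred_eq, TambaraIdeal.span_le, Set.iUnion_subset_iff,
        Set.mem_sInter]
      constructor
      · intro h Z hZ
        obtain ⟨I, rfl⟩ := hA hZ
        exact fun H => h H I hZ
      · intro h H I hI
        exact h _ hI H)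
    (by
      rintro _ ⟨I, rfl⟩ _ ⟨J, rfl⟩
      refine ⟨I.mul J, ?_⟩
      ext p
      constructor
      · exact p.isPrime.2 I J
      · rintro (h | h)
        · exact TambaraIdeal.span_le.2 fun H => (Ideal.mul_le_left).trans (h H)
        · exact TambaraIdeal.span_le.2 fun H => (Ideal.mul_le_right).trans (h H))

end NakaokaSpec

namespace TambaraHom

variable {S : TambaraFunctor.{u, v} G} {T : TambaraFunctor.{u, w} G}

/-- `f` is levelwise integral: each `S(G/H) → T(G/H)` is an integral ring homomorphism. -/
def LevelwiseIntegral (f : TambaraHom S T) : Prop :=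
  ∀ H : Subgroup G, (f.app (FinGSet.orbit H)).IsIntegral

/-- `f` is levelwise injective. -/
def LevelwiseInjective (f : TambaraHom S T) : Prop :=
  ∀ H : Subgroup G, Function.Injective (f.app (FinGSet.orbit H))

/-- The going up property (all displayed containments of primes are proper). -/
def GoingUp (f : TambaraHom S T) : Prop :=
  ∀ p₀ p₁ : TambaraIdeal S, p₀.IsPrime → p₁.IsPrime → p₀ < p₁ →
    ∀ q₀ : TambaraIdeal T, q₀.IsPrime → q₀.comap f = p₀ →
      ∃ q₁ : TambaraIdeal T, q₁.IsPrime ∧ q₀ < q₁ ∧ q₁.comap f = p₁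

end TambaraHom

end Ideals

/-! Levels of a prime Tambara ideal need not be prime ideals, so classical lying over cannot build
the required prime level by level; it only serves to control contractions. Let p be a prime of S and
J an ideal of T whose contraction lies in p. By Zorn, choose q maximal among the ideals that contain
J + pT and contract into p. The usual argument shows that q is prime (`isPrime_of_maximal`), and
since q contains pT its contraction is all of p. Going up is the case where J is the given prime of
T; lying over is the case J = 0. What remains is that J + pT itself contracts into p
(`comap_sup_map_le`).

This rests on two facts. First, the levels of a prime are radical rings ideals
(`IsPrime.isRadical`): if a² lies in P, then a long enough product of norms of restrictions of a
repeats a factor, hence lies in P, and primality then forces a into P. Second, (pT)(G/H) is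
contained in the radical of p(G/H)T(G/H) (`map_lev_le_radical`). Given these, write f(s) = j + t at
level G/H. For every ring prime 𝔯 containing p(G/H), classical lying over gives a prime 𝔰 of T(G/H)
over 𝔯 containing J(G/H). It contains j and t, so s lies in 𝔯; these 𝔯 intersect in p(G/H).

For the second fact, a generated ideal is the additive span of transfers of multiples of norms and
restrictions of generators (`MultiplicativeIdeal.gen`), so only elements tr(c f(y)) matter. A
characteristic polynomial argument, with elementary symmetric functions made from norms and
transfers, shows that y is nilpotent modulo restrictions from the ideal at G/H
(`mem_radical_map_res`). An induction on fibre size shows that transfers preserve nilpotence modulo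
an ideal of the target (`tr_mem_radical`). -/

open scoped Pointwise

/-! ### Finite G-sets: fibre products, coproducts, dependent products -/

namespace FinGSet

variable {G : Type u} [Group G]

/-- The sub-`G`-set cut out by a `G`-stable predicate. -/
abbrev sub (X : FinGSet G) (P : X → Prop) (hP : ∀ (g : G) (x : X), P x → P (g • x)) :
    FinGSet G :=
  ⟨({ carrier := {x | P x}, smul_mem' := fun g {x} hx => hP g x hx } : SubMulAction G X)⟩

/-- The inclusion of a sub-`G`-set. -/
def incl (X : FinGSet G) (P : X → Prop) (hP : ∀ (g : G) (x : X), P x → P (g • x)) :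
    X.sub P hP →[G] X where
  toFun := Subtype.val
  map_smul' _ _ := rfl

/-- The product of two finite `G`-sets. -/
abbrev prod (X Y : FinGSet G) : FinGSet G := ⟨X × Y⟩

/-- The first projection. -/
def fst (X Y : FinGSet G) : X.prod Y →[G] X where
  toFun := Prod.fst
  map_smul' _ _ := rfl

/-- The second projection. -/
def snd (X Y : FinGSet G) : X.prod Y →[G] Y where
  toFun := Prod.snd
  map_smul' _ _ := rfl

/-- The `G`-set of subsets of a finite `G`-set. -/
abbrev powerset (X : FinGSet G) : FinGSet G := ⟨Set X⟩

variable (G) in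
/-- The empty `G`-set. -/
def empty : FinGSet G where
  carrier := PEmpty
  action := { smul := fun _ x => x, one_smul := fun _ => rfl, mul_smul := fun _ _ _ => rfl }
  finite := inferInstance

/-- The map out of the empty `G`-set. -/
def ofEmpty (X : FinGSet G) : empty G →[G] X where
  toFun x := PEmpty.elim x
  map_smul' _ x := PEmpty.elim x

/-- The map out of a disjoint union defined by its two components. -/
def desc {X Y Z : FinGSet G} (f : X →[G] Z) (g : Y →[G] Z) : X.sum Y →[G] Z where
  toFun := Sum.elim f g
  map_smul' a t := by
    rcases t with x | y
    · exact map_smul f a x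
    · exact map_smul g a y

theorem desc_comp_inl {X Y Z : FinGSet G} (f : X →[G] Z) (g : Y →[G] Z) :
    (desc f g).comp (inl X Y) = f := rfl

theorem desc_comp_inr {X Y Z : FinGSet G} (f : X →[G] Z) (g : Y →[G] Z) :
    (desc f g).comp (inr X Y) = g := rfl

/-- The fibre product of `f` and `g`. -/
abbrev pullback {X Y Z : FinGSet G} (f : X →[G] Z) (g : Y →[G] Z) : FinGSet G :=
  (X.prod Y).sub (fun t => f t.1 = g t.2) fun a t ht => by
    change f (a • t.1) = g (a • t.2)
    rw [map_smul, map_smul, ht]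

/-- The first projection of the fibre product. -/
def pullbackFst {X Y Z : FinGSet G} (f : X →[G] Z) (g : Y →[G] Z) : pullback f g →[G] X :=
  (fst X Y).comp (incl _ _ _)

/-- The second projection of the fibre product. -/
def pullbackSnd {X Y Z : FinGSet G} (f : X →[G] Z) (g : Y →[G] Z) : pullback f g →[G] Y :=
  (snd X Y).comp (incl _ _ _)

theorem isCartesian_pullback {X Y Z : FinGSet G} (f : X →[G] Z) (g : Y →[G] Z) :
    IsCartesian (pullbackFst f g) (pullbackSnd f g) f g :=
  ⟨fun t => t.2, fun x y h => ⟨⟨(x, y), h⟩, ⟨rfl, rfl⟩, fun _ ht =>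
    Subtype.ext (Prod.ext ht.1 ht.2)⟩⟩

theorem isCartesian_id_of_injective {X Y : FinGSet G} {i : X →[G] Y}
    (hi : Function.Injective i) :
    IsCartesian (MulActionHom.id G (X := X)) (MulActionHom.id G (X := X)) i i :=
  ⟨fun _ => rfl, fun x _ h => ⟨x, ⟨rfl, hi h⟩, fun _ ht => ht.1⟩⟩

theorem isCartesian_ofEmpty {X Y Z : FinGSet G} {i : X →[G] Z} {j : Y →[G] Z}
    (h : ∀ x y, i x ≠ j y) : IsCartesian (ofEmpty X) (ofEmpty Y) i j :=
  ⟨fun t => PEmpty.elim t, fun x y hxy => (h x y hxy).elim⟩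

/-- `i` and `j` exhibit `W` as a disjoint union. -/
structure IsCoprod {A B W : FinGSet G} (i : A →[G] W) (j : B →[G] W) : Prop where
  left : Function.Injective i
  right : Function.Injective j
  disjoint : ∀ a b, i a ≠ j b
  cover : ∀ x, (∃ a, i a = x) ∨ ∃ b, j b = x

theorem IsCoprod.bijective_desc {A B W : FinGSet G} {i : A →[G] W} {j : B →[G] W}
    (h : IsCoprod i j) : Function.Bijective (desc i j) := by
  constructor
  · rintro (a | b) (a' | b') hab
    · exact congrArg Sum.inl (h.left hab)
    · exact (h.disjoint _ _ hab).elim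
    · exact (h.disjoint _ _ hab.symm).elim
    · exact congrArg Sum.inr (h.right hab)
  · intro x
    rcases h.cover x with ⟨a, rfl⟩ | ⟨b, rfl⟩
    · exact ⟨Sum.inl a, rfl⟩
    · exact ⟨Sum.inr b, rfl⟩

theorem isCoprod_inl_inr (X Y : FinGSet G) : IsCoprod (inl X Y) (inr X Y) where
  left := Sum.inl_injective
  right := Sum.inr_injective
  disjoint _ _ h := nomatch h
  cover := by
    rintro (a | b)
    · exact Or.inl ⟨a, rfl⟩
    · exact Or.inr ⟨b, rfl⟩

theorem isCoprod_incl (X : FinGSet G) (P : X → Prop) (hP : ∀ (g : G) (x : X), P x → P (g • x))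
    (hP' : ∀ (g : G) (x : X), ¬ P x → ¬ P (g • x)) :
    IsCoprod (incl X P hP) (incl X (fun x => ¬ P x) hP') where
  left := Subtype.val_injective
  right := Subtype.val_injective
  disjoint a b h := b.2 (by
    have : a.1 = b.1 := h
    rw [← this]; exact a.2)
  cover x := by
    by_cases hx : P x
    · exact Or.inl ⟨⟨x, hx⟩, rfl⟩
    · exact Or.inr ⟨⟨x, hx⟩, rfl⟩

theorem exists_compl {A W : FinGSet G} {i : A →[G] W} (hi : Function.Injective i) :
    ∃ (B : FinGSet G) (j : B →[G] W), IsCoprod i j ∧ ∀ x, (∃ b, j b = x) ↔ ¬ ∃ a, i a = x := by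
  refine ⟨W.sub (fun x => ¬ ∃ a, i a = x) ?_, incl _ _ _, ⟨hi, Subtype.val_injective, ?_, ?_⟩, ?_⟩
  · rintro g x hx ⟨a, ha⟩
    exact hx ⟨g⁻¹ • a, by rw [map_smul, ha, inv_smul_smul]⟩
  · intro a b h
    exact b.2 ⟨a, h⟩
  · intro x
    by_cases hx : ∃ a, i a = x
    · exact Or.inl hx
    · exact Or.inr ⟨⟨x, hx⟩, rfl⟩
  · intro x
    constructor
    · rintro ⟨b, rfl⟩
      exact b.2
    · intro hx
      exact ⟨⟨x, hx⟩, rfl⟩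

theorem exists_inverse {X Y : FinGSet G} {e : X →[G] Y} (he : Function.Bijective e) :
    ∃ e' : Y →[G] X, e'.comp e = MulActionHom.id G ∧ e.comp e' = MulActionHom.id G := by
  obtain ⟨l, hl, hr⟩ := Function.bijective_iff_has_inverse.1 he
  exact ⟨e.inverse l hl hr, MulActionHom.ext hl, MulActionHom.ext hr⟩

/-- The dependent product along `f`, as pairs of a point `y` and the image of a section over the
fibre of `y`. -/
theorem exists_isExponential {A X Y : FinGSet G} (h : A →[G] X) (f : X →[G] Y) :
    ∃ (B E : FinGSet G) (e : E →[G] A) (p : E →[G] B) (q : B →[G] Y),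
      IsExponential h f e p q := by
  let P : Y.prod A.powerset → Prop := fun t =>
    (∀ a ∈ t.2, f (h a) = t.1) ∧ ∀ x, f x = t.1 → ∃! a, a ∈ t.2 ∧ h a = x
  have hP : ∀ (g : G) (t), P t → P (g • t) := by
    rintro g ⟨y, U⟩ ⟨h₁, h₂⟩
    refine ⟨?_, ?_⟩
    · rintro _ ⟨a, ha, rfl⟩
      change f (h (g • a)) = g • y
      rw [map_smul, map_smul, h₁ a ha]
    · intro x hx
      change f x = g • y at hx
      obtain ⟨a, ⟨ha, hax⟩, hu⟩ := h₂ (g⁻¹ • x) (by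
        change f (g⁻¹ • x) = y
        rw [map_smul, hx, inv_smul_smul])
      refine ⟨g • a, ⟨Set.smul_mem_smul_set ha, by rw [map_smul, hax, smul_inv_smul]⟩, ?_⟩
      rintro _ ⟨⟨b, hb, rfl⟩, hbx⟩
      change h (g • b) = x at hbx
      change g • b = g • a
      rw [hu b ⟨hb, by rw [← hbx, map_smul, inv_smul_smul]⟩]
  let B : FinGSet G := (Y.prod A.powerset).sub P hP
  let E : FinGSet G := (A.prod B).sub (fun t => t.1 ∈ t.2.1.2) fun g t ht =>
    Set.smul_mem_smul_set (a := g) ht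
  refine ⟨B, E, (fst _ _).comp (incl _ _ _), (snd _ _).comp (incl _ _ _),
    (fst _ _).comp (incl _ _ _), ⟨?_, ?_⟩, ?_⟩
  · exact fun t => t.1.2.2.1 _ t.2
  · intro x b hxb
    obtain ⟨a, ⟨ha, hax⟩, hu⟩ := b.2.2 x hxb
    refine ⟨⟨(a, b), ha⟩, ⟨hax, rfl⟩, ?_⟩
    rintro ⟨⟨a', b'⟩, ha'⟩ ⟨h₁, h₂⟩
    change b' = b at h₂
    subst h₂
    obtain rfl := hu a' ⟨ha', h₁⟩
    rfl
  · intro y σ hσ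
    refine ⟨⟨(y, Set.range σ), ?_, ?_⟩, ⟨rfl, ?_⟩, ?_⟩
    · rintro _ ⟨x, rfl⟩
      rw [hσ]
      exact x.2
    · intro x hx
      refine ⟨σ ⟨x, hx⟩, ⟨⟨_, rfl⟩, hσ _⟩, ?_⟩
      rintro _ ⟨⟨x', rfl⟩, hx'⟩
      rw [hσ] at hx'
      exact congrArg σ (Subtype.ext hx')
    · rintro ⟨⟨a, b⟩, hab⟩ ht hb
      change b = _ at hb
      subst hb
      obtain ⟨x, hx⟩ := hab
      change σ x = a at hx
      subst hx
      change σ x = σ ⟨h (σ x), _⟩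
      congr 1
      exact Subtype.ext (hσ x).symm
    · rintro ⟨⟨y', U⟩, hU⟩ ⟨hy, hb⟩
      change y' = y at hy
      subst hy
      have key : ∀ a (ha : a ∈ U), a = σ ⟨h a, hU.1 a ha⟩ := fun a ha =>
        hb ⟨(a, ⟨(y', U), hU⟩), ha⟩ (hU.1 a ha) rfl
      refine Subtype.ext (Prod.ext rfl (Set.ext fun a => ⟨fun ha => ⟨_, (key a ha).symm⟩, ?_⟩))
      rintro ⟨x, rfl⟩
      obtain ⟨a, ⟨ha, hax⟩, -⟩ := hU.2 x.1 x.2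
      have : σ x = a := by
        rw [key a ha]
        exact congrArg σ (Subtype.ext hax.symm)
      rw [this]
      exact ha

/-- Surjectivity of p excludes empty fibres, over which a norm would be the empty product 1 and
leave every proper ideal. -/
theorem IsExponential.surjective {A X Y B E : FinGSet G} {h : A →[G] X} {f : X →[G] Y}
    {e : E →[G] A} {p : E →[G] B} {q : B →[G] Y} (H : IsExponential h f e p q)
    (hf : Function.Surjective f) : Function.Surjective p := by
  intro b
  obtain ⟨x, hx⟩ := hf (q b)
  obtain ⟨t, ht, -⟩ := H.1.2 x b hx
  exact ⟨t, ht.2⟩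

/-- The exponential diagram that multiplies a transfer along `h` by an element of its target. -/
theorem isExponential_frobenius {X Y : FinGSet G} (h : X →[G] Y) :
    IsExponential (desc ((inl Y Y).comp (MulActionHom.id G)) ((inr Y Y).comp h))
      (desc (MulActionHom.id G (X := Y)) (MulActionHom.id G))
      (desc ((inl Y X).comp h) (inr Y X)) (desc (MulActionHom.id G (X := X)) (MulActionHom.id G))
      h := by
  refine ⟨⟨?_, ?_⟩, ?_⟩
  · rintro (x | x) <;> rfl
  · rintro (y | y) x hxy
    · change y = h x at hxy
      subst hxy
      refine ⟨Sum.inl x, ⟨rfl, rfl⟩, ?_⟩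
      rintro (x' | x') ⟨h₁, h₂⟩
      · exact congrArg Sum.inl h₂
      · exact nomatch h₁
    · change y = h x at hxy
      subst hxy
      refine ⟨Sum.inr x, ⟨rfl, rfl⟩, ?_⟩
      rintro (x' | x') ⟨h₁, h₂⟩
      · exact nomatch h₁
      · exact congrArg Sum.inr h₂
  · intro y σ hσ
    -- The fibre of the fold map over y is two copies of y. A section has no choice on the left copy
    -- and picks a point of h⁻¹(y) on the right one, so the dependent product is X.
    obtain ⟨x, hx⟩ : ∃ x : X, σ ⟨Sum.inr y, rfl⟩ = Sum.inr x := by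
      rcases hs : σ ⟨Sum.inr y, rfl⟩ with a | a
      · have := hσ ⟨Sum.inr y, rfl⟩
        rw [hs] at this
        exact nomatch this
      · exact ⟨a, rfl⟩
    have hxy : h x = y := by
      have := hσ ⟨Sum.inr y, rfl⟩
      rw [hx] at this
      exact Sum.inr_injective this
    have hy : σ ⟨Sum.inl y, rfl⟩ = Sum.inl y := by
      have := hσ ⟨Sum.inl y, rfl⟩
      rcases hs : σ ⟨Sum.inl y, rfl⟩ with a | a
      · rw [hs] at this
        exact congrArg Sum.inl (Sum.inl_injective this)
      · rw [hs] at this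
        exact nomatch this
    refine ⟨x, ⟨hxy, ?_⟩, ?_⟩
    · rintro (t | t) ht hp
      · change t = x at hp
        subst hp
        subst hxy
        exact hy.symm
      · change t = x at hp
        subst hp
        subst hxy
        exact hx.symm
    · rintro x' ⟨h₁, h₂⟩
      change X.carrier at x'
      subst h₁
      have := h₂ (Sum.inr x') rfl rfl
      exact Sum.inr_injective (this.trans hx)

end FinGSet

/-! ### Additivity, multiplicativity and Frobenius reciprocity -/

namespace TambaraFunctor

open FinGSet

variable {G : Type u} [Group G] (T : TambaraFunctor.{u, v} G)

theorem res_comp_eq {X Y Z : FinGSet G} {f : X →[G] Y} {g : Y →[G] Z} {h : X →[G] Z}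
    (H : g.comp f = h) (t : T.obj Z) : T.res f (T.res g t) = T.res h t := by
  rw [← H, T.res_comp]

theorem res_injective_of_bijective {X Y : FinGSet G} {e : X →[G] Y}
    (he : Function.Bijective e) : Function.Injective (T.res e) := by
  obtain ⟨e', -, h⟩ := exists_inverse he
  exact Function.LeftInverse.injective (g := T.res e') fun t => by
    rw [T.res_comp_eq h, T.res_id]

theorem res_tr_of_injective {X Y : FinGSet G} {i : X →[G] Y} (hi : Function.Injective i)
    (t : T.obj X) : T.res i (T.tr i t) = t := by
  rw [T.res_tr _ _ _ _ (isCartesian_id_of_injective hi), T.tr_id, T.res_id]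

theorem res_nm_of_injective {X Y : FinGSet G} {i : X →[G] Y} (hi : Function.Injective i)
    (t : T.obj X) : T.res i (T.nm i t) = t := by
  rw [T.res_nm _ _ _ _ (isCartesian_id_of_injective hi), T.nm_id, T.res_id]

theorem tr_res_of_bijective {X Y : FinGSet G} {e : X →[G] Y} (he : Function.Bijective e)
    (t : T.obj Y) : T.tr e (T.res e t) = t :=
  T.res_injective_of_bijective he (T.res_tr_of_injective he.1 _)

theorem nm_res_of_bijective {X Y : FinGSet G} {e : X →[G] Y} (he : Function.Bijective e)
    (t : T.obj Y) : T.nm e (T.res e t) = t :=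
  T.res_injective_of_bijective he (T.res_nm_of_injective he.1 _)

theorem res_tr_of_disjoint {X Y Z : FinGSet G} {i : X →[G] Z} {j : Y →[G] Z}
    (h : ∀ x y, i x ≠ j y) (t : T.obj X) : T.res j (T.tr i t) = 0 := by
  have := T.obj_empty (empty G) ⟨PEmpty.elim⟩
  rw [T.res_tr _ _ _ _ (isCartesian_ofEmpty h), Subsingleton.elim (T.res (ofEmpty X) t) 0,
    map_zero]

theorem res_nm_of_disjoint {X Y Z : FinGSet G} {i : X →[G] Z} {j : Y →[G] Z}
    (h : ∀ x y, i x ≠ j y) (t : T.obj X) : T.res j (T.nm i t) = 1 := by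
  have := T.obj_empty (empty G) ⟨PEmpty.elim⟩
  rw [T.res_nm _ _ _ _ (isCartesian_ofEmpty h), Subsingleton.elim (T.res (ofEmpty X) t) 1,
    map_one]

section Coprod

variable {A B W : FinGSet G} {i : A →[G] W} {j : B →[G] W} (h : IsCoprod i j)
include h

theorem ext_of_isCoprod {s t : T.obj W} (hi : T.res i s = T.res i t)
    (hj : T.res j s = T.res j t) : s = t := by
  apply T.res_injective_of_bijective h.bijective_desc
  apply (T.obj_sum A B).1
  refine Prod.ext ?_ ?_
  · change T.res (inl A B) (T.res (desc i j) s) = T.res (inl A B) (T.res (desc i j) t)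
    rw [T.res_comp_eq (desc_comp_inl i j), T.res_comp_eq (desc_comp_inl i j), hi]
  · change T.res (inr A B) (T.res (desc i j) s) = T.res (inr A B) (T.res (desc i j) t)
    rw [T.res_comp_eq (desc_comp_inr i j), T.res_comp_eq (desc_comp_inr i j), hj]

theorem eq_tr_add_tr (t : T.obj W) : t = T.tr i (T.res i t) + T.tr j (T.res j t) := by
  apply T.ext_of_isCoprod h
  · rw [map_add, T.res_tr_of_injective h.left,
      T.res_tr_of_disjoint fun b a => (h.disjoint a b).symm, add_zero]
  · rw [map_add, T.res_tr_of_injective h.right, T.res_tr_of_disjoint h.disjoint, zero_add]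

theorem eq_nm_mul_nm (t : T.obj W) : t = T.nm i (T.res i t) * T.nm j (T.res j t) := by
  apply T.ext_of_isCoprod h
  · rw [map_mul, T.res_nm_of_injective h.left,
      T.res_nm_of_disjoint fun b a => (h.disjoint a b).symm, mul_one]
  · rw [map_mul, T.res_nm_of_injective h.right, T.res_nm_of_disjoint h.disjoint, one_mul]

theorem tr_eq_add {Z : FinGSet G} (f : W →[G] Z) (t : T.obj W) :
    T.tr f t = T.tr (f.comp i) (T.res i t) + T.tr (f.comp j) (T.res j t) := by
  conv_lhs => rw [T.eq_tr_add_tr h t]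
  rw [map_add, T.tr_comp, T.tr_comp]

theorem nm_eq_mul {Z : FinGSet G} (f : W →[G] Z) (t : T.obj W) :
    T.nm f t = T.nm (f.comp i) (T.res i t) * T.nm (f.comp j) (T.res j t) := by
  conv_lhs => rw [T.eq_nm_mul_nm h t]
  rw [map_mul, T.nm_comp, T.nm_comp]

theorem exists_res_eq (a : T.obj A) (b : T.obj B) : ∃ t, T.res i t = a ∧ T.res j t = b := by
  refine ⟨T.tr i a + T.tr j b, ?_, ?_⟩
  · rw [map_add, T.res_tr_of_injective h.left,
      T.res_tr_of_disjoint fun b a => (h.disjoint a b).symm, add_zero]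
  · rw [map_add, T.res_tr_of_injective h.right, T.res_tr_of_disjoint h.disjoint, zero_add]

end Coprod

theorem tr_of_isEmpty {X Y : FinGSet G} (hX : IsEmpty X) (f : X →[G] Y) (t : T.obj X) :
    T.tr f t = 0 := by
  have := T.obj_empty X hX
  rw [Subsingleton.elim t 0, map_zero]

theorem nm_of_isEmpty {X Y : FinGSet G} (hX : IsEmpty X) (f : X →[G] Y) (t : T.obj X) :
    T.nm f t = 1 := by
  have := T.obj_empty X hX
  rw [Subsingleton.elim t 1, map_one]

/-- Frobenius reciprocity. -/
theorem mul_tr {X Y : FinGSet G} (h : X →[G] Y) (y : T.obj Y) (x : T.obj X) :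
    y * T.tr h x = T.tr h (T.res h y * x) := by
  obtain ⟨t, rfl, rfl⟩ := T.exists_res_eq (isCoprod_inl_inr Y X) y x
  -- Norms along fold maps are products, so the distributive law for the pair (y, x), pushed to Y ⊔
  -- Y and then folded, is exactly Frobenius reciprocity.
  have H := T.nm_tr _ _ _ _ _ (isExponential_frobenius h) t
  have key : ∀ {Z : FinGSet G} (f : Z →[G] Z) (z : T.obj Z), f = MulActionHom.id G →
      T.nm f z = z := by
    rintro Z f z rfl
    exact T.nm_id Z z
  rw [T.nm_eq_mul (isCoprod_inl_inr Y Y)] at H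
  rw [T.nm_eq_mul (isCoprod_inl_inr X X)] at H
  rw [key _ _ (desc_comp_inl _ _), key _ _ (desc_comp_inr _ _), key _ _ (desc_comp_inl _ _),
    key _ _ (desc_comp_inr _ _), T.res_comp_eq (desc_comp_inl _ _),
    T.res_comp_eq (desc_comp_inr _ _), T.res_comp] at H
  have e₁ : (desc ((inl Y Y).comp (MulActionHom.id G)) ((inr Y Y).comp h)).comp (inl Y X) =
      inl Y Y := rfl
  have e₂ : (desc ((inl Y Y).comp (MulActionHom.id G)) ((inr Y Y).comp h)).comp (inr Y X) =
      (inr Y Y).comp h := rfl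
  have hY := isCoprod_inl_inr Y Y
  rw [← H, T.tr_eq_add (isCoprod_inl_inr Y X), e₁, e₂, T.tr_comp (inr Y Y) h, map_add, map_add,
    T.res_tr_of_injective hY.left, T.res_tr_of_injective hY.right,
    T.res_tr_of_disjoint hY.disjoint, T.res_tr_of_disjoint fun b a => (hY.disjoint a b).symm,
    add_zero, zero_add]

end TambaraFunctor

/-! ### Maps between orbits and orbit decompositions -/

section OrbitMaps

open FinGSet

variable {G : Type u} [Group G] [Finite G]

/-- The coset `xH`. -/
def FinGSet.orbit.mk (H : Subgroup G) (x : G) : orbit H := QuotientGroup.mk x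

theorem FinGSet.orbit.mk_surjective (H : Subgroup G) : Function.Surjective (orbit.mk H) :=
  QuotientGroup.mk_surjective

theorem FinGSet.orbit.smul_mk (H : Subgroup G) (g x : G) :
    g • orbit.mk H x = orbit.mk H (g * x) := rfl

theorem FinGSet.orbit.mk_eq_mk {H : Subgroup G} {x y : G} :
    orbit.mk H x = orbit.mk H y ↔ x⁻¹ * y ∈ H :=
  QuotientGroup.eq

theorem FinGSet.exists_orbit_injective {W : FinGSet G} (x : W) :
    ∃ (H : Subgroup G) (i : orbit H →[G] W), Function.Injective i ∧ ∃ a, i a = x :=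
  ⟨MulAction.stabilizer G x,
    { toFun := MulAction.ofQuotientStabilizer G x
      map_smul' := MulAction.ofQuotientStabilizer_smul G x },
    MulAction.injective_ofQuotientStabilizer G x, orbit.mk _ 1, one_smul G x⟩

theorem exists_eq_orbitConj_comp_orbitProj {K H : Subgroup G} (φ : orbit K →[G] orbit H) :
    ∃ (g : G) (h : K ≤ conjSubgroup H g), φ = (orbitConj H g).comp (orbitProj h) := by
  obtain ⟨g, hg⟩ := orbit.mk_surjective H (φ (orbit.mk K 1))
  have key : ∀ x : G, φ (orbit.mk K x) = orbit.mk H (x * g) := by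
    intro x
    rw [← mul_one x, ← orbit.smul_mk, map_smul, ← hg, mul_one]
    rfl
  have hK : K ≤ conjSubgroup H g := by
    intro k hk
    have h₁ : orbit.mk K 1 = orbit.mk K k := orbit.mk_eq_mk.2 (by simpa using hk)
    have h₂ := key k
    rw [← h₁, key 1, one_mul, orbit.mk_eq_mk] at h₂
    exact ⟨g⁻¹ * (k * g), h₂, by simp [mul_assoc]⟩
  refine ⟨g, hK, MulActionHom.ext fun x => ?_⟩
  obtain ⟨x, rfl⟩ := orbit.mk_surjective K x
  exact key x

theorem orbitConj_bijective (H : Subgroup G) (g : G) : Function.Bijective (orbitConj H g) := by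
  constructor
  · intro x y hxy
    obtain ⟨x, rfl⟩ := orbit.mk_surjective (conjSubgroup H g) x
    obtain ⟨y, rfl⟩ := orbit.mk_surjective (conjSubgroup H g) y
    have h₁ : orbit.mk H (x * g) = orbit.mk H (y * g) := hxy
    rw [orbit.mk_eq_mk] at h₁
    exact orbit.mk_eq_mk.2 ⟨_, h₁, by simp [mul_assoc]⟩
  · intro y
    obtain ⟨y, rfl⟩ := orbit.mk_surjective H y
    exact ⟨orbit.mk (conjSubgroup H g) (y * g⁻¹),
      congrArg (orbit.mk H) (inv_mul_cancel_right y g)⟩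

theorem orbit_map_surjective {X : FinGSet G} {H : Subgroup G} (f : X →[G] orbit H) (x : X) :
    Function.Surjective f := by
  intro y
  obtain ⟨g, hg⟩ := MulAction.exists_smul_eq (M := G) (α := G ⧸ H) (f x) y
  exact ⟨g • x, (map_smul f g x).trans hg⟩

theorem TambaraFunctor.tr_mem_of_orbits (T : TambaraFunctor.{u, v} G) {X : FinGSet G}
    (M : AddSubgroup (T.obj X)) {D : FinGSet G} (h : D →[G] X) (z : T.obj D)
    (H : ∀ (K : Subgroup G) (φ : orbit K →[G] D), T.tr (h.comp φ) (T.res φ z) ∈ M) :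
    T.tr h z ∈ M := by
  induction hn : Nat.card D using Nat.strong_induction_on generalizing D with
  | _ n ih =>
    rcases isEmpty_or_nonempty D with hD | ⟨⟨x⟩⟩
    · rw [T.tr_of_isEmpty hD]
      exact M.zero_mem
    · obtain ⟨K, i, hi, a, hx⟩ := exists_orbit_injective x
      obtain ⟨B, j, hij, hB⟩ := exists_compl hi
      rw [T.tr_eq_add hij]
      -- Split off the orbit of x; its complement misses x and is strictly smaller.
      refine M.add_mem (H K i) (ih (Nat.card B) ?_ (h.comp j) (T.res j z) ?_ rfl)
      · rw [← hn]
        refine Nat.lt_of_le_of_ne (Nat.card_le_card_of_injective j hij.right) fun hcard => ?_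
        have hb : Function.Bijective j :=
          (Nat.bijective_iff_injective_and_card j).2 ⟨hij.right, hcard⟩
        obtain ⟨b, hb⟩ := hb.2 x
        exact (hB x).1 ⟨b, hb⟩ ⟨a, hx⟩
      · intro L φ
        have := H L (j.comp φ)
        rwa [T.res_comp] at this

end OrbitMaps

/-! ### Generating Tambara ideals by transfers -/

section MultiplicativeIdeals

open FinGSet

variable {G : Type u} [Group G] [Finite G]

/-- Subsets of the levels of a Tambara functor which are closed under multiplication by arbitrary
elements, restriction and norm. -/
structure MultiplicativeIdeal (T : TambaraFunctor.{u, v} G) where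
  carrier : ∀ H : Subgroup G, Set (T.level H)
  mul_mem : ∀ {H : Subgroup G} (c : T.level H) {x : T.level H},
    x ∈ carrier H → c * x ∈ carrier H
  res_mem : ∀ {K H : Subgroup G} (φ : orbit K →[G] orbit H) {x : T.level H},
    x ∈ carrier H → T.res φ x ∈ carrier K
  nm_mem : ∀ {K H : Subgroup G} (φ : orbit K →[G] orbit H) {x : T.level K},
    x ∈ carrier K → T.nm φ x ∈ carrier H

namespace MultiplicativeIdeal

variable {T : TambaraFunctor.{u, v} G} (A : MultiplicativeIdeal T)

/-- The elements of `T(X)` all of whose restrictions to orbits lie in `A`. -/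
def ext (X : FinGSet G) : Set (T.obj X) :=
  {z | ∀ (H : Subgroup G) (φ : orbit H →[G] X), T.res φ z ∈ A.carrier H}

variable {A}

theorem mem_ext_orbit {H : Subgroup G} {z : T.level H} :
    z ∈ A.ext (orbit H) ↔ z ∈ A.carrier H :=
  ⟨fun h => by simpa only [T.res_id] using h H (MulActionHom.id G), fun h _ φ => A.res_mem φ h⟩

theorem mul_mem_ext {X : FinGSet G} (c : T.obj X) {z : T.obj X} (hz : z ∈ A.ext X) :
    c * z ∈ A.ext X := fun H φ => by
  rw [map_mul]
  exact A.mul_mem _ (hz H φ)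

theorem res_mem_ext {X Y : FinGSet G} (f : X →[G] Y) {z : T.obj Y} (hz : z ∈ A.ext Y) :
    T.res f z ∈ A.ext X := fun H φ => by
  rw [T.res_comp_eq rfl]
  exact hz H _

/-- Over an orbit of Y the norm is a product over the orbits of the fibre product. Surjectivity
supplies at least one factor, and one factor in `A` suffices since `A` absorbs multiplication. -/
theorem nm_mem_ext {X Y : FinGSet G} (f : X →[G] Y) (hf : Function.Surjective f) {z : T.obj X}
    (hz : z ∈ A.ext X) : T.nm f z ∈ A.ext Y := fun H φ => by
  rw [T.res_nm _ _ _ _ (isCartesian_pullback f φ)]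
  obtain ⟨x, hx⟩ := hf (φ (orbit.mk H 1))
  obtain ⟨K, i, hi, -⟩ := exists_orbit_injective (W := pullback f φ) ⟨(x, _), hx⟩
  obtain ⟨B, j, hij, -⟩ := exists_compl hi
  rw [T.nm_eq_mul hij, mul_comm]
  refine A.mul_mem _ (A.nm_mem _ ?_)
  rw [T.res_comp_eq rfl]
  exact hz K _

theorem mem_ext_of_isCoprod {X Y W : FinGSet G} {i : X →[G] W} {j : Y →[G] W}
    (h : IsCoprod i j) {z : T.obj W} (hi : T.res i z ∈ A.ext X) (hj : T.res j z ∈ A.ext Y) :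
    z ∈ A.ext W := by
  intro H φ
  -- A map out of an orbit lands entirely in the summand that contains the image of the base coset.
  have lift : ∀ {V : FinGSet G} (k : V →[G] W), Function.Injective k →
      T.res k z ∈ A.ext V → (∃ a, k a = φ (orbit.mk H 1)) →
      T.res φ z ∈ A.carrier H := by
    rintro V k hk hz ⟨a, ha⟩
    have hr : ∀ x, ∃ b, k b = φ x := by
      intro x
      obtain ⟨x, rfl⟩ := orbit.mk_surjective H x
      refine ⟨x • a, ?_⟩
      rw [map_smul, ha, ← map_smul, orbit.smul_mk, mul_one]
    choose r hr using hr
    let ψ : orbit H →[G] V :=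
      { toFun := r
        map_smul' := fun g x => hk (by rw [hr, map_smul, id, map_smul, hr]) }
    have : φ = k.comp ψ := MulActionHom.ext fun x => (hr x).symm
    rw [this, T.res_comp]
    exact hz H ψ
  exact (h.cover _).elim (lift i h.left hi) (lift j h.right hj)

variable (A)

/-- The Tambara ideal generated by a multiplicative ideal: it consists of the transfers. -/
def gen : TambaraIdeal T :=
  have res : ∀ {K H : Subgroup G} (φ : orbit K →[G] orbit H) {x : T.level H},
      (∃ (D : FinGSet G) (h : D →[G] orbit H), ∃ z ∈ A.ext D, T.tr h z = x) →
      ∃ (D : FinGSet G) (h : D →[G] orbit K), ∃ z ∈ A.ext D, T.tr h z = T.res φ x := by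
    rintro K H φ _ ⟨D, h, z, hz, rfl⟩
    exact ⟨_, _, _, res_mem_ext _ hz, (T.res_tr _ _ _ _ (isCartesian_pullback h φ) z).symm⟩
  { lev := fun H =>
      { carrier := {x | ∃ (D : FinGSet G) (h : D →[G] orbit H), ∃ z ∈ A.ext D, T.tr h z = x}
        zero_mem' := ⟨empty G, ofEmpty _, 0,
          fun K φ => PEmpty.elim (φ (orbit.mk K 1)), map_zero _⟩
        add_mem' := by
          rintro _ _ ⟨D, h, z, hz, rfl⟩ ⟨D', h', z', hz', rfl⟩
          have hD := isCoprod_inl_inr D D'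
          obtain ⟨t, rfl, rfl⟩ := T.exists_res_eq hD z z'
          refine ⟨D.sum D', desc h h', t, mem_ext_of_isCoprod hD hz hz', ?_⟩
          rw [T.tr_eq_add hD, desc_comp_inl, desc_comp_inr]
        smul_mem' := by
          rintro c _ ⟨D, h, z, hz, rfl⟩
          exact ⟨D, h, _, mul_mem_ext _ hz, (T.mul_tr h c z).symm⟩ }
    tr_mem := by
      rintro K H hKH _ ⟨D, h, z, hz, rfl⟩
      exact ⟨D, _, z, hz, T.tr_comp _ _ _⟩
    nm_mem := by
      rintro K H hKH _ ⟨D, h, z, hz, rfl⟩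
      -- The distributive law turns the norm of a transfer into the transfer of a norm along p,
      -- which is surjective.
      obtain ⟨B, E, e, p, q, hE⟩ := exists_isExponential h (orbitProj hKH)
      exact ⟨B, q, _, nm_mem_ext p
        (hE.surjective (orbit_map_surjective _ (orbit.mk K 1)))
        (res_mem_ext e hz), (T.nm_tr _ _ _ _ _ hE z).symm⟩
    res_mem := fun h _ hx => res (orbitProj h) hx
    conj_mem := fun H g _ hx => res (orbitConj H g) hx }

variable {A}

theorem mem_gen_of_mem {H : Subgroup G} {x : T.level H} (hx : x ∈ A.carrier H) :
    x ∈ A.gen.lev H :=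
  ⟨_, MulActionHom.id G, x, mem_ext_orbit.2 hx, T.tr_id _ _⟩

/-- The generated ideal is the additive span of transfers along maps of orbits. -/
theorem mem_of_mem_gen {H : Subgroup G} (M : AddSubgroup (T.level H))
    (hM : ∀ (K : Subgroup G) (φ : orbit K →[G] orbit H), ∀ z ∈ A.carrier K, T.tr φ z ∈ M)
    {x : T.level H} (hx : x ∈ A.gen.lev H) : x ∈ M := by
  obtain ⟨D, h, z, hz, rfl⟩ := hx
  exact T.tr_mem_of_orbits M h z fun K φ => hM K _ _ (hz K φ)

end MultiplicativeIdeal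

/-! ### Tambara ideals evaluated on all finite G-sets -/

namespace TambaraIdeal

variable {T : TambaraFunctor.{u, v} G} (I : TambaraIdeal T)

theorem res_orbit_mem {K H : Subgroup G} (φ : orbit K →[G] orbit H) {x : T.level H}
    (hx : x ∈ I.lev H) : T.res φ x ∈ I.lev K := by
  obtain ⟨g, h, rfl⟩ := exists_eq_orbitConj_comp_orbitProj φ
  rw [T.res_comp]
  exact I.res_mem h (I.conj_mem H g hx)

/-- The definition of an ideal mentions conjugations only through restriction. This form lets
transfers and norms along `orbitConj` be replaced by restriction along its inverse. -/
theorem exists_res_eq_of_orbitConj (H : Subgroup G) (g : G) (x : T.level (conjSubgroup H g)) :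
    ∃ ψ : orbit H →[G] orbit (conjSubgroup H g), x = T.res (orbitConj H g) (T.res ψ x) := by
  obtain ⟨ψ, h, -⟩ := exists_inverse (orbitConj_bijective H g)
  exact ⟨ψ, by rw [T.res_comp_eq h, T.res_id]⟩

theorem tr_orbit_mem {K H : Subgroup G} (φ : orbit K →[G] orbit H) {x : T.level K}
    (hx : x ∈ I.lev K) : T.tr φ x ∈ I.lev H := by
  obtain ⟨g, h, rfl⟩ := exists_eq_orbitConj_comp_orbitProj φ
  rw [T.tr_comp]
  obtain ⟨ψ, hψ⟩ := exists_res_eq_of_orbitConj H g (T.tr (orbitProj h) x)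
  rw [hψ, T.tr_res_of_bijective (orbitConj_bijective H g)]
  exact I.res_orbit_mem ψ (I.tr_mem h hx)

theorem nm_orbit_mem {K H : Subgroup G} (φ : orbit K →[G] orbit H) {x : T.level K}
    (hx : x ∈ I.lev K) : T.nm φ x ∈ I.lev H := by
  obtain ⟨g, h, rfl⟩ := exists_eq_orbitConj_comp_orbitProj φ
  rw [T.nm_comp]
  obtain ⟨ψ, hψ⟩ := exists_res_eq_of_orbitConj H g (T.nm (orbitProj h) x)
  rw [hψ, T.nm_res_of_bijective (orbitConj_bijective H g)]
  exact I.res_orbit_mem ψ (I.nm_mem h hx)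

/-- The multiplicative ideal underlying a Tambara ideal. -/
def toMultiplicativeIdeal : MultiplicativeIdeal T where
  carrier H := I.lev H
  mul_mem c _ hx := (I.lev _).mul_mem_left c hx
  res_mem φ _ hx := I.res_orbit_mem φ hx
  nm_mem φ _ hx := I.nm_orbit_mem φ hx

/-- The extension of a Tambara ideal to all finite `G`-sets. -/
def ideal (X : FinGSet G) : Ideal (T.obj X) where
  carrier := I.toMultiplicativeIdeal.ext X
  zero_mem' H φ := by
    rw [map_zero]
    exact (I.lev H).zero_mem
  add_mem' hx hy H φ := by
    rw [map_add]
    exact (I.lev H).add_mem (hx H φ) (hy H φ)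
  smul_mem' c _ hx := MultiplicativeIdeal.mul_mem_ext c hx

variable {I}

theorem mem_ideal_orbit {H : Subgroup G} {x : T.level H} : x ∈ I.ideal (orbit H) ↔ x ∈ I.lev H :=
  MultiplicativeIdeal.mem_ext_orbit (A := I.toMultiplicativeIdeal)

theorem res_mem_ideal {X Y : FinGSet G} (f : X →[G] Y) {z : T.obj Y} (hz : z ∈ I.ideal Y) :
    T.res f z ∈ I.ideal X :=
  MultiplicativeIdeal.res_mem_ext (A := I.toMultiplicativeIdeal) f hz

theorem nm_mem_ideal {X Y : FinGSet G} (f : X →[G] Y) (hf : Function.Surjective f) {z : T.obj X}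
    (hz : z ∈ I.ideal X) : T.nm f z ∈ I.ideal Y :=
  MultiplicativeIdeal.nm_mem_ext (A := I.toMultiplicativeIdeal) f hf hz

theorem tr_mem_ideal {X Y : FinGSet G} (f : X →[G] Y) {z : T.obj X}
    (hz : z ∈ I.ideal X) : T.tr f z ∈ I.ideal Y := fun H φ => by
  rw [T.res_tr _ _ _ _ (isCartesian_pullback f φ)]
  refine T.tr_mem_of_orbits (I.lev H).toAddSubgroup _ _ fun K ψ => I.tr_orbit_mem _ ?_
  rw [T.res_comp_eq rfl]
  exact hz K _

end TambaraIdeal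

end MultiplicativeIdeals

/-! ### Products, sums and inverse images of ideals -/

section Primes

open FinGSet

variable {G : Type u} [Group G] [Finite G] {T : TambaraFunctor.{u, v} G}

theorem TambaraIdeal.mul_le {I J K : TambaraIdeal T} :
    I.mul J ≤ K ↔ ∀ H, ∀ x ∈ I.lev H, ∀ y ∈ J.lev H, x * y ∈ K.lev H :=
  TambaraIdeal.span_le.trans (forall_congr' fun _ => Ideal.mul_le)

namespace MultiplicativeIdeal

theorem gen_le {A : MultiplicativeIdeal T} {J : TambaraIdeal T} :
    A.gen ≤ J ↔ ∀ H, A.carrier H ⊆ J.lev H :=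
  ⟨fun h H _ hx => h H (mem_gen_of_mem hx), fun h H _ hx =>
    mem_of_mem_gen (J.lev H).toAddSubgroup (fun _ φ _ hz => J.tr_orbit_mem φ (h _ hz)) hx⟩

/-- Two applications of Frobenius reciprocity move both transfers outside, leaving a product of
generators at a common level. -/
theorem gen_mul_gen_le {A B : MultiplicativeIdeal T} {J : TambaraIdeal T}
    (h : ∀ H, ∀ x ∈ A.carrier H, ∀ y ∈ B.carrier H, x * y ∈ J.lev H) :
    A.gen.mul B.gen ≤ J := by
  refine TambaraIdeal.mul_le.2 fun H x hx y hy => ?_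
  refine mem_of_mem_gen ((J.lev H).toAddSubgroup.comap (AddMonoidHom.mulRight y)) ?_ hx
  intro K φ z hz
  change T.tr φ z * y ∈ J.lev H
  rw [mul_comm, T.mul_tr]
  refine J.tr_orbit_mem φ ?_
  refine mem_of_mem_gen ((J.lev K).toAddSubgroup.comap (AddMonoidHom.mulRight z)) ?_
    (B.gen.res_orbit_mem φ hy)
  intro L ψ w hw
  change T.tr ψ w * z ∈ J.lev K
  rw [mul_comm, T.mul_tr]
  exact J.tr_orbit_mem ψ (h L _ (A.res_mem ψ hz) _ hw)

/-- The union of two multiplicative ideals. -/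
def union (A B : MultiplicativeIdeal T) : MultiplicativeIdeal T where
  carrier H := A.carrier H ∪ B.carrier H
  mul_mem c _ := Or.imp (A.mul_mem c) (B.mul_mem c)
  res_mem φ _ := Or.imp (A.res_mem φ) (B.res_mem φ)
  nm_mem φ _ := Or.imp (A.nm_mem φ) (B.nm_mem φ)

variable (T) in
/-- The empty multiplicative ideal. -/
def empty : MultiplicativeIdeal T where
  carrier _ := ∅
  mul_mem _ _ h := h
  res_mem _ _ h := h
  nm_mem _ _ h := h

theorem eq_zero_of_mem_gen_empty {H : Subgroup G} {x : T.level H}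
    (hx : x ∈ (empty T).gen.lev H) : x = 0 :=
  (AddSubgroup.mem_bot (G := T.level H)).1 (mem_of_mem_gen ⊥ (fun _ _ z hz => absurd hz (Set.notMem_empty z)) hx)

end MultiplicativeIdeal

namespace TambaraIdeal

/-- The sum of two Tambara ideals. -/
def sup (I J : TambaraIdeal T) : TambaraIdeal T :=
  (I.toMultiplicativeIdeal.union J.toMultiplicativeIdeal).gen

theorem le_sup_left (I J : TambaraIdeal T) : I ≤ I.sup J :=
  fun _ _ hx => MultiplicativeIdeal.mem_gen_of_mem (Or.inl hx)

theorem le_sup_right (I J : TambaraIdeal T) : J ≤ I.sup J :=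
  fun _ _ hx => MultiplicativeIdeal.mem_gen_of_mem (Or.inr hx)

theorem sup_lev (I J : TambaraIdeal T) (H : Subgroup G) :
    (I.sup J).lev H = I.lev H ⊔ J.lev H := by
  refine le_antisymm (fun x hx => ?_) (sup_le (I.le_sup_left J H) (I.le_sup_right J H))
  refine MultiplicativeIdeal.mem_of_mem_gen (I.lev H ⊔ J.lev H).toAddSubgroup ?_ hx
  rintro K φ z (hz | hz)
  · exact Submodule.mem_sup_left (I.tr_orbit_mem φ hz)
  · exact Submodule.mem_sup_right (J.tr_orbit_mem φ hz)

/-- Norms send 1 to 1, so the bottom level already controls all others. -/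
theorem eq_top_of_one_mem {I : TambaraIdeal T} (h : (1 : T.level ⊥) ∈ I.lev ⊥) : I = ⊤ := by
  have h₁ : ∀ H, (1 : T.level H) ∈ I.lev H := fun H => by
    have := I.nm_mem (bot_le : ⊥ ≤ H) h
    rwa [map_one] at this
  exact TambaraIdeal.ext (funext fun H => (Ideal.eq_top_iff_one _).2 (h₁ H))

section Map

variable {S : TambaraFunctor.{u, w} G} (f : TambaraHom S T)

/-- The multiplicative ideal of multiples of the image of a Tambara ideal. -/
def image (I : TambaraIdeal S) : MultiplicativeIdeal T where
  carrier H := {x | ∃ (c : T.level H), ∃ y ∈ I.lev H, c * f.app _ y = x}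
  mul_mem := by
    rintro H d _ ⟨c, y, hy, rfl⟩
    exact ⟨d * c, y, hy, mul_assoc _ _ _⟩
  res_mem := by
    rintro K H φ _ ⟨c, y, hy, rfl⟩
    exact ⟨_, _, I.res_orbit_mem φ hy, by rw [f.app_res, map_mul]⟩
  nm_mem := by
    rintro K H φ _ ⟨c, y, hy, rfl⟩
    exact ⟨_, _, I.nm_orbit_mem φ hy, by rw [f.app_nm, map_mul]⟩

/-- The Tambara ideal generated by the image of a Tambara ideal. -/
def map (I : TambaraIdeal S) : TambaraIdeal T := (I.image f).gen

variable {f}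

theorem map_le_iff_le_comap {I : TambaraIdeal S} {J : TambaraIdeal T} :
    I.map f ≤ J ↔ I ≤ J.comap f := by
  refine MultiplicativeIdeal.gen_le.trans (forall_congr' fun H => ⟨fun h x hx => ?_, ?_⟩)
  · exact h ⟨1, x, hx, one_mul _⟩
  · rintro h _ ⟨c, y, hy, rfl⟩
    exact (J.lev H).mul_mem_left c (h hy)

theorem comap_ne_top {I : TambaraIdeal T} (hI : I ≠ ⊤) : I.comap f ≠ ⊤ := by
  intro h
  refine hI (eq_top_of_one_mem ?_)
  have : (1 : S.level ⊥) ∈ (I.comap f).lev ⊥ := by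
    rw [h]
    exact Submodule.mem_top
  have h₁ : f.app _ 1 ∈ I.lev ⊥ := this
  rwa [map_one] at h₁

theorem IsPrime.comap {P : TambaraIdeal T} (hP : P.IsPrime) : (P.comap f).IsPrime := by
  refine ⟨comap_ne_top hP.1, fun I J hIJ => ?_⟩
  refine (hP.2 (I.map f) (J.map f) ?_).imp map_le_iff_le_comap.1 map_le_iff_le_comap.1
  refine MultiplicativeIdeal.gen_mul_gen_le ?_
  rintro H _ ⟨c, x, hx, rfl⟩ _ ⟨d, y, hy, rfl⟩
  rw [mul_mul_mul_comm, ← map_mul]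
  exact (P.lev H).mul_mem_left _ (mul_le.1 hIJ H x hx y hy)

end Map

/-! ### Levels of a prime ideal are radical -/

/-- The index set of the elements of `T(G/H)` obtained from an element of `T(G/L)` by a restriction
followed by a norm. -/
abbrev TranslateIndex (L H : Subgroup G) : Type u :=
  Σ K : Subgroup G, (orbit K →[G] orbit H) × (orbit K →[G] orbit L)

instance (L H : Subgroup G) : Finite (TranslateIndex L H) := by
  have h : ∀ X Y : FinGSet G, Finite (X →[G] Y) := fun X Y =>
    Finite.of_injective (fun f : X →[G] Y => (f : X → Y)) DFunLike.coe_injective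
  have := h
  infer_instance

/-- The norm of a restriction of `a`. -/
def translate {L : Subgroup G} (a : T.level L) {H : Subgroup G} (i : TranslateIndex L H) :
    T.level H :=
  T.nm i.2.1 (T.res i.2.2 a)

/-- Base change expresses the restriction of a norm as a product over the orbits of a nonempty fibre
product, and each orbit contributes a translate. -/
theorem exists_translate_dvd_res {L : Subgroup G} (a : T.level L) {H H' : Subgroup G}
    (φ : orbit H' →[G] orbit H) (i : TranslateIndex L H) :
    ∃ i' : TranslateIndex L H', translate a i' ∣ T.res φ (translate a i) := by
  obtain ⟨K, α, β⟩ := i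
  change ∃ i' : TranslateIndex L H', translate a i' ∣ T.res φ (T.nm α (T.res β a))
  rw [T.res_nm _ _ _ _ (isCartesian_pullback α φ)]
  obtain ⟨x, hx⟩ := orbit_map_surjective α (orbit.mk K 1) (φ (orbit.mk H' 1))
  obtain ⟨K', i, hi, -⟩ := exists_orbit_injective (W := pullback α φ) ⟨(x, _), hx⟩
  obtain ⟨B, j, hij, -⟩ := exists_compl hi
  rw [T.nm_eq_mul hij]
  refine ⟨⟨K', (pullbackSnd α φ).comp i, β.comp ((pullbackFst α φ).comp i)⟩,
    Dvd.intro _ (congrArg (· * _) ?_)⟩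
  change T.nm _ (T.res _ a) = _
  rw [T.res_comp, T.res_comp]

/-- The multiplicative ideal of multiples of products of `n` translates of `a`. -/
def translatePow {L : Subgroup G} (a : T.level L) (n : ℕ) : MultiplicativeIdeal T where
  carrier H := {x | ∃ s : Multiset (TranslateIndex L H), s.card = n ∧
    (s.map (translate a)).prod ∣ x}
  mul_mem := by
    rintro H c x ⟨s, hs, h⟩
    exact ⟨s, hs, h.mul_left c⟩
  res_mem := by
    rintro H' H φ x ⟨s, hs, h⟩
    choose r hr using exists_translate_dvd_res a φ
    refine ⟨s.map r, by rw [Multiset.card_map, hs], dvd_trans ?_ (map_dvd (T.res φ) h)⟩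
    rw [Multiset.map_map, map_multiset_prod, Multiset.map_map]
    exact Multiset.prod_dvd_prod_of_dvd _ _ fun i _ => hr i
  nm_mem := by
    rintro K H φ x ⟨s, hs, h⟩
    refine ⟨s.map fun i => ⟨i.1, φ.comp i.2.1, i.2.2⟩, by rw [Multiset.card_map, hs],
      dvd_trans ?_ (map_dvd (T.nm φ) h)⟩
    rw [Multiset.map_map, map_multiset_prod, Multiset.map_map]
    exact Multiset.prod_dvd_prod_of_dvd _ _ fun i _ => (T.nm_comp _ _ _).dvd

/-- If a is not in P, the ideal generated by single translates is not in P, and repeated squaring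
shows the same for products of 2ⁿ translates. But there are finitely many translates, so for large n
some translate occurs twice, and its square is a translate of a². -/
theorem IsPrime.mem_of_sq_mem {P : TambaraIdeal T} (hP : P.IsPrime) {L : Subgroup G}
    {a : T.level L} (ha : a ^ 2 ∈ P.lev L) : a ∈ P.lev L := by
  by_contra hna
  have h : ∀ n : ℕ, ¬ (translatePow a (2 ^ n)).gen ≤ P := by
    intro n
    induction n with
    | zero =>
      intro hle
      refine hna (hle L (MultiplicativeIdeal.mem_gen_of_mem
        ⟨{⟨L, MulActionHom.id G, MulActionHom.id G⟩}, rfl, ?_⟩))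
      rw [Multiset.map_singleton, Multiset.prod_singleton]
      change T.nm _ (T.res _ a) ∣ a
      rw [T.nm_id, T.res_id]
    | succ n ih =>
      intro hle
      refine (hP.2 _ _ (MultiplicativeIdeal.gen_mul_gen_le ?_)).elim ih ih
      rintro H x ⟨s, hs, hx⟩ y ⟨t, ht, hy⟩
      refine hle H (MultiplicativeIdeal.mem_gen_of_mem ⟨s + t, ?_, ?_⟩)
      · rw [Multiset.card_add, hs, ht, pow_succ, mul_two]
      · rw [Multiset.map_add, Multiset.prod_add]
        exact mul_dvd_mul hx hy
  have hfin : Finite (Σ H : Subgroup G, TranslateIndex L H) := inferInstance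
  -- Summing over all subgroups gives a number N that bounds the translates at every level at once;
  -- 2^N > N then forces a repetition.
  refine h (Nat.card (Σ H : Subgroup G, TranslateIndex L H))
    (MultiplicativeIdeal.gen_le.2 ?_)
  rintro H x ⟨s, hs, c, rfl⟩
  refine (P.lev H).mul_mem_right _ ?_
  classical
  have hnd : ¬ s.Nodup := by
    intro hnd
    have h₁ : s.card ≤ Nat.card (TranslateIndex L H) := by
      have := Fintype.ofFinite (TranslateIndex L H)
      rw [Nat.card_eq_fintype_card]
      exact Finset.card_le_univ (⟨s, hnd⟩ : Finset _)
    have h₂ : Nat.card (TranslateIndex L H) ≤ Nat.card (Σ H : Subgroup G, TranslateIndex L H) :=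
      Nat.card_le_card_of_injective (Sigma.mk H) sigma_mk_injective
    have h₃ := Nat.lt_two_pow_self (n := Nat.card (Σ H : Subgroup G, TranslateIndex L H))
    omega
  obtain ⟨i, hi⟩ : ∃ i, i ::ₘ i ::ₘ 0 ≤ s := by
    by_contra hno
    push Not at hno
    exact hnd (Multiset.nodup_iff_le.2 hno)
  obtain ⟨t, rfl⟩ := Multiset.le_iff_exists_add.1 hi
  rw [Multiset.map_add, Multiset.prod_add]
  refine (P.lev H).mul_mem_right _ ?_
  rw [Multiset.map_cons, Multiset.map_cons, Multiset.prod_cons, Multiset.prod_cons,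
    Multiset.map_zero, Multiset.prod_zero, mul_one, ← sq, translate, ← map_pow, ← map_pow]
  exact P.nm_orbit_mem _ (P.res_orbit_mem _ ha)

/-- The levels of a prime ideal are radical. -/
theorem IsPrime.isRadical {P : TambaraIdeal T} (hP : P.IsPrime) (H : Subgroup G) :
    (P.lev H).IsRadical := by
  rintro x ⟨n, hn⟩
  have h : ∀ k : ℕ, x ^ 2 ^ k ∈ P.lev H → x ∈ P.lev H := by
    intro k
    induction k with
    | zero => intro h; simpa using h
    | succ k ih =>
      intro h
      rw [pow_succ, pow_mul] at h
      exact ih (hP.mem_of_sq_mem h)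
  exact h n (Ideal.pow_mem_of_pow_mem _ hn Nat.lt_two_pow_self.le)

end TambaraIdeal

end Primes

/-! ### Norms over families of subsets -/

section Integrality

open FinGSet

variable {G : Type u} [Group G] {T : TambaraFunctor.{u, v} G}

namespace FinGSet

/-- The `G`-set of pairs of a point `z` and a point of the subset `r z`. -/
abbrev points {X Z : FinGSet G} (r : Z →[G] X.powerset) : FinGSet G :=
  (X.prod Z).sub (fun t => t.1 ∈ r t.2) fun g t ht => by
    change g • t.1 ∈ r (g • t.2)
    rw [map_smul]
    exact Set.smul_mem_smul_set ht

/-- The point of `X` underlying an element of `points r`. -/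
def pointsFst {X Z : FinGSet G} (r : Z →[G] X.powerset) : points r →[G] X :=
  (fst X Z).comp (incl _ _ _)

/-- The structure map of `points r`. -/
def pointsSnd {X Z : FinGSet G} (r : Z →[G] X.powerset) : points r →[G] Z :=
  (snd X Z).comp (incl _ _ _)

/-- Removing a point from a family of subsets. -/
def erase {X Z : FinGSet G} (r : Z →[G] X.powerset) (s : Z →[G] X) : Z →[G] X.powerset where
  toFun z := r z \ {s z}
  map_smul' g z := by
    rw [map_smul, map_smul]
    change g • r z \ {g • s z} = g • (r z \ {s z})
    rw [Set.smul_set_sdiff, Set.smul_set_singleton]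

end FinGSet

namespace TambaraFunctor

variable (T) in
/-- The product of the values of `x` over a family of subsets, defined as a norm. -/
def prodOver {X Z : FinGSet G} (x : T.obj X) (r : Z →[G] X.powerset) : T.obj Z :=
  T.nm (pointsSnd r) (T.res (pointsFst r) x)

theorem res_prodOver {X Z Z' : FinGSet G} (x : T.obj X) (r : Z →[G] X.powerset) (g : Z' →[G] Z) :
    T.res g (T.prodOver x r) = T.prodOver x (r.comp g) := by
  let a : points (r.comp g) →[G] points r :=
    { toFun := fun t => ⟨(t.1.1, g t.1.2), t.2⟩
      map_smul' := fun c t => Subtype.ext (Prod.ext rfl (map_smul g c t.1.2)) }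
  have h : IsCartesian a (pointsSnd (r.comp g)) (pointsSnd r) g := by
    refine ⟨fun _ => rfl, ?_⟩
    rintro ⟨⟨x, z⟩, hx⟩ z' hz
    change z = g z' at hz
    subst hz
    refine ⟨⟨(x, z'), hx⟩, ⟨rfl, rfl⟩, ?_⟩
    rintro ⟨⟨y, w⟩, hy⟩ ⟨h₁, h₂⟩
    change w = z' at h₂
    subst h₂
    have h₃ : y = x := congrArg (fun t => t.1.1) h₁
    subst h₃
    rfl
  unfold prodOver
  rw [T.res_nm _ _ _ _ h, T.res_comp_eq rfl]
  rfl

theorem prodOver_eq_mul {X Z : FinGSet G} (x : T.obj X) (r : Z →[G] X.powerset) (s : Z →[G] X)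
    (hs : ∀ z, s z ∈ r z) : T.prodOver x r = T.res s x * T.prodOver x (erase r s) := by
  let i : Z →[G] points r :=
    { toFun := fun z => ⟨(s z, z), hs z⟩
      map_smul' := fun c z => Subtype.ext (Prod.ext (map_smul s c z) rfl) }
  let j : points (erase r s) →[G] points r :=
    { toFun := fun t => ⟨t.1, t.2.1⟩
      map_smul' := fun c z => rfl }
  have h : IsCoprod i j :=
    { left := fun z z' h => congrArg (fun t => t.1.2) h
      right := fun t t' h => Subtype.ext (congrArg (fun t : points r => t.1) h)
      disjoint := by
        rintro z t h
        have h₁ : (s z, z) = t.1 := congrArg Subtype.val h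
        refine t.2.2 ?_
        rw [← h₁]
        rfl
      cover := by
        rintro ⟨⟨y, z⟩, hy⟩
        by_cases h : y = s z
        · subst h
          exact Or.inl ⟨z, rfl⟩
        · exact Or.inr ⟨⟨(y, z), hy, h⟩, rfl⟩ }
  unfold prodOver
  rw [T.nm_eq_mul h, T.res_comp_eq rfl, T.res_comp_eq rfl]
  congr 1
  exact T.nm_id _ _

theorem prodOver_of_forall_eq_empty {X Z : FinGSet G} (x : T.obj X) (r : Z →[G] X.powerset)
    (hr : ∀ z, r z = ∅) : T.prodOver x r = 1 :=
  T.nm_of_isEmpty ⟨fun t : points r => Set.eq_empty_iff_forall_notMem.1 (hr t.1.2) _ t.2⟩ _ _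

theorem _root_.TambaraIdeal.prodOver_mem [Finite G] (I : TambaraIdeal T) {X Z : FinGSet G}
    {x : T.obj X} (hx : x ∈ I.ideal X) (r : Z →[G] X.powerset) (hr : ∀ z, (r z).Nonempty) :
    T.prodOver x r ∈ I.ideal Z := by
  refine TambaraIdeal.nm_mem_ideal _ (fun z => ?_) (TambaraIdeal.res_mem_ideal _ hx)
  obtain ⟨y, hy⟩ := hr z
  exact ⟨⟨(y, z), hy⟩, rfl⟩

end TambaraFunctor

/-! ### Elementary symmetric transfers and nilpotence -/

namespace FinGSet

variable {X Y : FinGSet G} (f : X →[G] Y)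

theorem ncard_smul {X : FinGSet G} (g : G) (U : Set X) : (g • U).ncard = U.ncard :=
  Set.ncard_image_of_injective U (MulAction.injective g)

theorem map_eq_smul_of_mem_smul {g : G} {U : Set X} {y : Y} (h : ∀ u ∈ U, f u = y) :
    ∀ u ∈ g • U, f u = g • y := by
  rintro _ ⟨u, hu, rfl⟩
  change f (g • u) = g • y
  rw [map_smul, h u hu]

/-- The `G`-set of pairs of a point `y` and a `k`-element subset of the fibre over `y`. -/
abbrev fibreSubsets (k : ℕ) : FinGSet G :=
  (Y.prod X.powerset).sub (fun t => t.2.ncard = k ∧ ∀ u ∈ t.2, f u = t.1) fun g t ht =>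
    ⟨(ncard_smul g t.2).trans ht.1, map_eq_smul_of_mem_smul f ht.2⟩

/-- The `G`-set of pairs of a point `x` and a `k`-element subset of the fibre through `x`. -/
abbrev pointedFibreSubsets (k : ℕ) : FinGSet G :=
  (X.prod X.powerset).sub (fun t => t.2.ncard = k ∧ ∀ u ∈ t.2, f u = f t.1) fun g t ht =>
    ⟨(ncard_smul g t.2).trans ht.1, fun u hu =>
      (map_eq_smul_of_mem_smul f ht.2 u hu).trans (map_smul f g t.1).symm⟩

theorem smul_mem_iff {t : X.prod X.powerset} (g : G) :
    (g • t).1 ∈ (g • t).2 ↔ t.1 ∈ t.2 :=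
  Set.smul_mem_smul_set_iff

/-- The pairs of a point and a `k`-element subset of its fibre containing the point. -/
abbrev inSubsets (k : ℕ) : FinGSet G :=
  (pointedFibreSubsets f k).sub (fun t => t.1.1 ∈ t.1.2) fun g _ ht => (smul_mem_iff g).2 ht

/-- The pairs of a point and a `k`-element subset of its fibre not containing the point. -/
abbrev outSubsets (k : ℕ) : FinGSet G :=
  (pointedFibreSubsets f k).sub (fun t => ¬ t.1.1 ∈ t.1.2) fun g _ ht =>
    fun h => ht ((smul_mem_iff g).1 h)

/-- The point underlying an element of `pointedFibreSubsets`. -/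
def pointedFst (k : ℕ) : pointedFibreSubsets f k →[G] X := (fst _ _).comp (incl _ _ _)

/-- The subset underlying an element of `pointedFibreSubsets`. -/
def pointedSnd (k : ℕ) : pointedFibreSubsets f k →[G] X.powerset := (snd _ _).comp (incl _ _ _)

/-- The inclusion of `inSubsets`. -/
def inIncl (k : ℕ) : inSubsets f k →[G] pointedFibreSubsets f k := incl _ _ _

/-- The inclusion of `outSubsets`. -/
def outIncl (k : ℕ) : outSubsets f k →[G] pointedFibreSubsets f k := incl _ _ _

/-- Removing the point from the subset. -/
def inToOut (k : ℕ) : inSubsets f (k + 1) →[G] outSubsets f k where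
  toFun t := ⟨⟨(t.1.1.1, t.1.1.2 \ {t.1.1.1}), by
    have ht : t.1.1.1 ∈ t.1.1.2 := t.2
    have hk : t.1.1.2.ncard = k + 1 := t.1.2.1
    change (t.1.1.2 \ {t.1.1.1}).ncard = k
    rw [Set.ncard_sdiff_singleton_of_mem ht, hk, Nat.add_sub_cancel],
    fun u hu => t.1.2.2 u hu.1⟩, fun h => h.2 rfl⟩
  map_smul' g t := by
    refine Subtype.ext (Subtype.ext (Prod.ext rfl ?_))
    change (g • t.1.1.2) \ {g • t.1.1.1} = g • (t.1.1.2 \ {t.1.1.1})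
    rw [Set.smul_set_sdiff, Set.smul_set_singleton]

theorem inToOut_bijective (k : ℕ) : Function.Bijective (inToOut f k) := by
  constructor
  · rintro ⟨⟨⟨x, U⟩, hU⟩, hx⟩ ⟨⟨⟨x', U'⟩, hU'⟩, hx'⟩ h
    have h₁ : x = x' := congrArg (fun t => t.1.1.1) h
    have h₂ : U \ {x} = U' \ {x'} := congrArg (fun t => t.1.1.2) h
    subst h₁
    change x ∈ U at hx
    change x ∈ U' at hx'
    have h₃ : U = U' := by
      rw [← Set.insert_sdiff_self_of_mem hx, h₂, Set.insert_sdiff_self_of_mem hx']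
    subst h₃
    rfl
  · rintro ⟨⟨⟨x, U⟩, hU⟩, hx⟩
    change x ∉ U at hx
    refine ⟨⟨⟨(x, insert x U), ?_, ?_⟩, Set.mem_insert x U⟩, ?_⟩
    · change (insert x U).ncard = k + 1
      rw [Set.ncard_insert_of_notMem hx (Set.toFinite U)]
      exact congrArg (· + 1) hU.1
    · rintro u (rfl | hu)
      · rfl
      · exact hU.2 u hu
    · refine Subtype.ext (Subtype.ext (Prod.ext rfl ?_))
      change insert x U \ {x} = U
      exact Set.insert_sdiff_self_of_notMem hx

end FinGSet

namespace TambaraFunctor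

variable {X Y : FinGSet G} (f : X →[G] Y) (x : T.obj X)

/-- The `k`-th elementary symmetric transfer of `x` along `f`. -/
def esymmTr (k : ℕ) : T.obj Y :=
  T.tr ((fst _ _).comp (incl _ _ _) : fibreSubsets f k →[G] Y)
    (T.prodOver x ((snd _ _).comp (incl _ _ _)))

/-- The variant of `esymmTr` for the complement of the diagonal in the base change of `f` along
itself. -/
def esymmTrCompl (k : ℕ) : T.obj X :=
  T.tr ((pointedFst f k).comp (outIncl f k))
    (T.prodOver x ((pointedSnd f k).comp (outIncl f k)))

theorem esymmTrCompl_zero : esymmTrCompl f x 0 = 1 := by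
  have hb : Function.Bijective ((pointedFst f 0).comp (outIncl f 0)) := by
    constructor
    · rintro ⟨⟨⟨x, U⟩, hU⟩, hx⟩ ⟨⟨⟨x', U'⟩, hU'⟩, hx'⟩ h
      change x = x' at h
      subst h
      have h₁ : U = ∅ := (Set.ncard_eq_zero (Set.toFinite U)).1 hU.1
      have h₂ : U' = ∅ := (Set.ncard_eq_zero (Set.toFinite U')).1 hU'.1
      subst h₁
      subst h₂
      rfl
    · intro x
      exact ⟨⟨⟨(x, ∅), Set.ncard_empty X, fun u hu => (Set.notMem_empty u hu).elim⟩,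
        Set.notMem_empty x⟩, rfl⟩
  unfold esymmTrCompl
  rw [prodOver_of_forall_eq_empty, ← map_one (T.res ((pointedFst f 0).comp (outIncl f 0))),
    T.tr_res_of_bijective hb]
  exact fun z => (Set.ncard_eq_zero (Set.toFinite _)).1 z.1.2.1

/-- A subset with as many elements as X is X itself and cannot avoid the marked point. -/
theorem esymmTrCompl_card : esymmTrCompl f x (Nat.card X) = 0 := by
  refine T.tr_of_isEmpty ⟨?_⟩ _ _
  rintro ⟨⟨⟨x, U⟩, hU⟩, hx⟩
  have h : U.ncard = Nat.card X := hU.1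
  rw [← Set.eq_univ_iff_ncard] at h
  subst h
  exact hx (Set.mem_univ x)

/-- The analogue of e_{k+1}(x, x') = e_{k+1}(x') + x e_k(x'), where x' stands for the other
conjugates of x: after base change to X, sort subsets by whether they contain the marked point. -/
theorem res_esymmTr_succ (k : ℕ) :
    T.res f (esymmTr f x (k + 1)) = esymmTrCompl f x (k + 1) + x * esymmTrCompl f x k := by
  let a : pointedFibreSubsets f (k + 1) →[G] fibreSubsets f (k + 1) :=
    { toFun := fun t => ⟨(f t.1.1, t.1.2), t.2⟩
      map_smul' := fun g t => Subtype.ext (Prod.ext (map_smul f g t.1.1) rfl) }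
  have h : IsCartesian a (pointedFst f (k + 1)) ((fst _ _).comp (incl _ _ _)) f := by
    refine ⟨fun _ => rfl, ?_⟩
    rintro ⟨⟨y, U⟩, hU⟩ x hy
    change y = f x at hy
    subst hy
    refine ⟨⟨(x, U), hU⟩, ⟨rfl, rfl⟩, ?_⟩
    rintro ⟨⟨x', U'⟩, hU'⟩ ⟨h₁, h₂⟩
    change x' = x at h₂
    subst h₂
    have h₃ : U' = U := congrArg (fun t => t.1.2) h₁
    subst h₃
    rfl
  have hc : IsCoprod (inIncl f (k + 1)) (outIncl f (k + 1)) := isCoprod_incl _ _ _ _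
  unfold esymmTr
  rw [T.res_tr _ _ _ _ h, T.tr_eq_add hc, res_prodOver, res_prodOver, res_prodOver, add_comm]
  congr 1
  rw [prodOver_eq_mul x _ ((pointedFst f (k + 1)).comp (inIncl f (k + 1))) fun z => z.2,
    ← T.mul_tr]
  congr 1
  unfold esymmTrCompl
  have h₁ := T.tr_res_of_bijective (inToOut_bijective f k)
    (T.prodOver x ((pointedSnd f k).comp (outIncl f k)))
  rw [← h₁, ← T.tr_comp, res_prodOver]
  rfl

/-- Elements of an ideal are integral over the restrictions of elements of the ideal. -/
theorem _root_.TambaraIdeal.mem_radical_map_res [Finite G] (I : TambaraIdeal T) {x : T.obj X}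
    (hx : x ∈ I.ideal X) : x ∈ ((I.ideal Y).map (T.res f)).radical := by
  -- Only positive degrees lie in the ideal: the empty subset contributes the product 1.
  have hE : ∀ k, T.res f (esymmTr f x (k + 1)) ∈ (I.ideal Y).map (T.res f) := fun k =>
    Ideal.mem_map_of_mem _ (TambaraIdeal.tr_mem_ideal _ (I.prodOver_mem hx _ fun z =>
      Set.nonempty_of_ncard_ne_zero (by
        have : (z.1.2 : Set X).ncard = k + 1 := z.2.1
        exact this.trans_ne k.succ_ne_zero)))
  -- Modulo the ideal, the recursion of `res_esymmTr_succ` reads e'_{k+1} = -x e'_k with e'_0 = 1;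
  -- it ends in 0 at k = |X|, so a power of -x vanishes.
  have key : ∀ k, (-x) ^ k - esymmTrCompl f x k ∈ (I.ideal Y).map (T.res f) := by
    intro k
    induction k with
    | zero =>
      rw [pow_zero, esymmTrCompl_zero, sub_self]
      exact Ideal.zero_mem _
    | succ k ih =>
      have := Ideal.sub_mem _ (Ideal.mul_mem_left _ (-x) ih) (hE k)
      rw [res_esymmTr_succ] at this
      convert this using 1
      ring
  have := key (Nat.card X)
  rw [esymmTrCompl_card, sub_zero] at this
  have h : -x ∈ ((I.ideal Y).map (T.res f)).radical := ⟨_, this⟩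
  exact neg_mem_iff.1 h

/-- Transfers of elements which are nilpotent modulo an ideal of the target are nilpotent modulo
this ideal. -/
theorem tr_mem_radical {X Y : FinGSet G} (f : X →[G] Y) (𝔞 : Ideal (T.obj Y)) {x : T.obj X}
    (hx : x ∈ (𝔞.map (T.res f)).radical) : T.tr f x ∈ 𝔞.radical := by
  -- Induction on a bound for the fibre sizes: restricting the transfer back to X splits off x
  -- itself, and the rest is a transfer from the off-diagonal part of X ×_Y X, whose fibres over X
  -- have one point fewer.
  obtain ⟨n, hn⟩ : ∃ n, ∀ y, {x | f x = y}.ncard ≤ n :=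
    ⟨Nat.card X, fun y => Set.ncard_le_card _⟩
  induction n generalizing X Y with
  | zero =>
    have hX : IsEmpty X := ⟨fun x => by
      have := (Set.ncard_eq_zero (Set.toFinite _)).1 (Nat.le_zero.1 (hn (f x)))
      exact Set.eq_empty_iff_forall_notMem.1 this x rfl⟩
    rw [T.tr_of_isEmpty hX]
    exact Ideal.zero_mem _
  | succ n ih =>
    let D : FinGSet G := (pullback f f).sub (fun t => ¬ t.1.1 = t.1.2) fun g t ht h =>
      ht (smul_left_cancel g h)
    let j : D →[G] pullback f f := incl _ _ _
    let i : X →[G] pullback f f :=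
      { toFun := fun x => ⟨(x, x), rfl⟩
        map_smul' := fun _ _ => rfl }
    have hij : IsCoprod i j :=
      { left := fun x y h => congrArg (fun t => t.1.1) h
        right := Subtype.val_injective
        disjoint := fun x d h => d.2 (by
          rw [show d.1 = i x from h.symm]
          rfl)
        cover := by
          rintro ⟨⟨x, y⟩, hxy⟩
          by_cases h : x = y
          · subst h
            exact Or.inl ⟨x, rfl⟩
          · exact Or.inr ⟨⟨⟨(x, y), hxy⟩, h⟩, rfl⟩ }
    have hu : T.res f (T.tr f x) ∈ (𝔞.map (T.res f)).radical := by
      rw [T.res_tr _ _ _ _ (isCartesian_pullback f f), T.tr_eq_add hij]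
      refine Ideal.add_mem _ ?_ (ih _ _ ?_ ?_)
      · rw [T.res_comp_eq (h := MulActionHom.id G) rfl, T.res_id]
        have : T.tr ((pullbackSnd f f).comp i) x = x := T.tr_id _ _
        rwa [this]
      · rw [T.res_comp_eq rfl]
        -- Here x is restricted along the first projection while the transfer runs along the second;
        -- both have the same composite with f, so 𝔞 extends to D in the same way.
        have hD : (T.res (f.comp ((pullbackFst f f).comp j))) =
            (T.res (f.comp ((pullbackSnd f f).comp j))) := by
          congr 1
          exact MulActionHom.ext fun t => t.1.2
        have h₁ := Ideal.mem_map_of_mem (T.res ((pullbackFst f f).comp j)) hx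
        have h₂ := Ideal.map_radical_le _ h₁
        have hcomp : ∀ {Z : FinGSet G} (g : Z →[G] X),
            (𝔞.map (T.res f)).map (T.res g) = 𝔞.map (T.res (f.comp g)) := fun g => by
          rw [Ideal.map_map]
          congr 1
          exact RingHom.ext fun t => (T.res_comp f g t).symm
        rw [hcomp] at h₂ ⊢
        rwa [← hD]
      · intro y
        have h₁ : {t : D | ((pullbackSnd f f).comp j) t = y}.ncard ≤
            ({x | f x = f y} \ {y}).ncard := by
          refine Set.ncard_le_ncard_of_injOn (fun t : D => t.1.1.1) ?_ ?_
          · rintro ⟨⟨⟨a, b⟩, hab⟩, hne⟩ hb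
            change b = y at hb
            subst hb
            exact ⟨hab, hne⟩
          · rintro ⟨⟨⟨a, b⟩, hab⟩, hne⟩ hb ⟨⟨⟨a', b'⟩, hab'⟩, hne'⟩ hb' h
            change b = y at hb
            change b' = y at hb'
            change a = a' at h
            subst hb hb' h
            rfl
        refine h₁.trans ?_
        rw [Set.ncard_sdiff_singleton_of_mem (by rfl)]
        have := hn (f y)
        omega
    obtain ⟨k, hk⟩ := hu
    refine ⟨k + 1, ?_⟩
    -- With u = tr x and res(u)^k in the extension of 𝔞, Frobenius gives u^{k+1} = tr(res(u)^k x),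
    -- so it suffices that transfer maps this extension into 𝔞.
    have h₁ : ∀ z ∈ 𝔞.map (T.res f), ∀ w, T.tr f (w * z) ∈ 𝔞 := by
      intro z hz
      induction hz using Submodule.span_induction with
      | mem z hz =>
        obtain ⟨a, ha, rfl⟩ := hz
        intro w
        rw [mul_comm]
        exact (T.mul_tr f a w) ▸ 𝔞.mul_mem_right _ ha
      | zero =>
        intro w
        rw [mul_zero, map_zero]
        exact 𝔞.zero_mem
      | add a b _ _ iha ihb =>
        intro w
        rw [mul_add, map_add]
        exact 𝔞.add_mem (iha w) (ihb w)
      | smul c a _ iha =>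
        intro w
        rw [smul_eq_mul, ← mul_assoc]
        exact iha _
    have := h₁ _ hk x
    rwa [mul_comm, ← map_pow, ← T.mul_tr, ← pow_succ] at this

end TambaraFunctor

end Integrality

/-! ### Extension, contraction and lying over -/

section LyingOver

open FinGSet

variable {G : Type u} [Group G] [Finite G] {S : TambaraFunctor.{u, v} G}
  {T : TambaraFunctor.{u, w} G} {f : TambaraHom S T}

namespace TambaraIdeal

/-- Elements of the ideal generated by the image of `I` are nilpotent modulo the image of `I` in
the same level. -/
theorem map_lev_le_radical (I : TambaraIdeal S) (H : Subgroup G) :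
    (I.map f).lev H ≤ ((I.lev H).map (f.app (orbit H))).radical := by
  intro t ht
  refine MultiplicativeIdeal.mem_of_mem_gen
    ((I.lev H).map (f.app (orbit H))).radical.toAddSubgroup ?_ ht
  rintro K φ _ ⟨c, y, hy, rfl⟩
  refine T.tr_mem_radical φ _ (Ideal.mul_mem_left _ c ?_)
  have h₁ := Ideal.map_radical_le (f.app (orbit K))
    (Ideal.mem_map_of_mem (f.app (orbit K)) (I.mem_radical_map_res φ (mem_ideal_orbit.2 hy)))
  have h₂ : I.ideal (orbit H) = I.lev H := Ideal.ext fun _ => mem_ideal_orbit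
  have h₃ : (f.app (orbit K)).comp (S.res φ) = (T.res φ).comp (f.app (orbit H)) :=
    RingHom.ext fun s => f.app_res φ s
  rwa [h₂, Ideal.map_map, h₃, ← Ideal.map_map] at h₁

theorem comap_sup_map_le (hf : f.LevelwiseIntegral) {J : TambaraIdeal T} {p : TambaraIdeal S}
    (hp : p.IsPrime) (hJ : J.comap f ≤ p) : (J.sup (p.map f)).comap f ≤ p := by
  intro H s hs
  have hs' : f.app (orbit H) s ∈ (J.sup (p.map f)).lev H := hs
  rw [sup_lev] at hs'
  obtain ⟨j, hj, t, ht, hjt⟩ := Submodule.mem_sup.1 hs'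
  refine hp.isRadical H ?_
  -- Being radical, p(G/H) is the intersection of the ring primes above it, so s can be tested
  -- against each such 𝔯 by classical lying over.
  rw [Ideal.radical_eq_sInf, Submodule.mem_sInf]
  rintro 𝔯 ⟨h𝔯, h𝔯'⟩
  algebraize [f.app (orbit H)]
  have : Algebra.IsIntegral (S.obj (orbit H)) (T.obj (orbit H)) := ⟨hf H⟩
  obtain ⟨𝔰, hJ𝔰, h𝔰, hc⟩ := Ideal.exists_ideal_over_prime_of_isIntegral 𝔯 (J.lev H)
    ((hJ H).trans h𝔯)
  rw [← hc]
  change f.app (orbit H) s ∈ 𝔰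
  rw [← hjt]
  refine 𝔰.add_mem (hJ𝔰 hj) (h𝔰.radical.le ?_)
  refine Ideal.radical_mono ?_ (p.map_lev_le_radical H ht)
  rw [Ideal.map_le_iff_le_comap]
  exact h𝔯.trans hc.ge

/-- The union of a nonempty chain of Tambara ideals. -/
theorem exists_mem_lev_iff_of_isChain {c : Set (TambaraIdeal T)} (hc : IsChain (· ≤ ·) c)
    {I₀ : TambaraIdeal T} (h₀ : I₀ ∈ c) :
    ∃ U : TambaraIdeal T, ∀ H x, x ∈ U.lev H ↔ ∃ I ∈ c, x ∈ I.lev H := by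
  refine ⟨
    { lev := fun H =>
        { carrier := {x | ∃ I ∈ c, x ∈ I.lev H}
          zero_mem' := ⟨I₀, h₀, Ideal.zero_mem _⟩
          add_mem' := ?_
          smul_mem' := ?_ }
      tr_mem := ?_
      nm_mem := ?_
      res_mem := ?_
      conj_mem := ?_ }, fun _ _ => Iff.rfl⟩
  · rintro x y ⟨I, hI, hx⟩ ⟨J, hJ, hy⟩
    rcases hc.total hI hJ with h | h
    · exact ⟨J, hJ, Ideal.add_mem _ (h H hx) hy⟩
    · exact ⟨I, hI, Ideal.add_mem _ hx (h H hy)⟩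
  · rintro a x ⟨I, hI, hx⟩
    exact ⟨I, hI, Ideal.mul_mem_left _ a hx⟩
  · rintro K H h x ⟨I, hI, hx⟩
    exact ⟨I, hI, I.tr_mem h hx⟩
  · rintro K H h x ⟨I, hI, hx⟩
    exact ⟨I, hI, I.nm_mem h hx⟩
  · rintro K H h x ⟨I, hI, hx⟩
    exact ⟨I, hI, I.res_mem h hx⟩
  · rintro H g x ⟨I, hI, hx⟩
    exact ⟨I, hI, I.conj_mem H g hx⟩

/-- An ideal which is maximal among those whose inverse image is contained in a given prime ideal
is prime. -/
theorem isPrime_of_maximal {p : TambaraIdeal S} (hp : p.IsPrime) {q : TambaraIdeal T}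
    (hq : q.comap f ≤ p) (hmax : ∀ I : TambaraIdeal T, q ≤ I → I.comap f ≤ p → I ≤ q) :
    q.IsPrime := by
  refine ⟨?_, fun I J hIJ => ?_⟩
  · rintro rfl
    exact hp.1 (le_antisymm (fun _ _ _ => Submodule.mem_top) hq)
  by_contra! h
  have key : ∀ I : TambaraIdeal T, ¬ I ≤ q → ¬ (I.sup q).comap f ≤ p := fun I hI h =>
    hI (le_trans (I.le_sup_left q) (hmax _ (I.le_sup_right q) h))
  -- By maximality neither I + q nor J + q contracts into p, yet (I + q)(J + q) ⊆ IJ + q ⊆ q, which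
  -- does.
  refine (hp.2 ((I.sup q).comap f) ((J.sup q).comap f) ?_).elim (key I h.1) (key J h.2)
  refine mul_le.2 fun H x hx y hy => hq H ?_
  have hx' : f.app (orbit H) x ∈ (I.sup q).lev H := hx
  have hy' : f.app (orbit H) y ∈ (J.sup q).lev H := hy
  change f.app (orbit H) (x * y) ∈ q.lev H
  rw [sup_lev] at hx' hy'
  rw [map_mul]
  obtain ⟨a, ha, b, hb, hab⟩ := Submodule.mem_sup.1 hx'
  obtain ⟨c, hc, d, hd, hcd⟩ := Submodule.mem_sup.1 hy'
  rw [← hab, ← hcd, mul_add, add_mul]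
  exact Ideal.add_mem _ (Ideal.add_mem _ (mul_le.1 hIJ H a ha c hc) (Ideal.mul_mem_right _ _ hb))
    (Ideal.mul_mem_left _ _ hd)

/-- Lying over for a levelwise integral morphism, relative to an ideal of the target. -/
theorem exists_isPrime_comap_eq (hf : f.LevelwiseIntegral) {J : TambaraIdeal T}
    {p : TambaraIdeal S} (hp : p.IsPrime) (hJ : J.comap f ≤ p) :
    ∃ q : TambaraIdeal T, q.IsPrime ∧ J ≤ q ∧ q.comap f = p := by
  -- Starting Zorn at J + pT rather than at J forces the contraction of q to be all of p.
  obtain ⟨q, hq₀, hq⟩ := zorn_le_nonempty₀ {I : TambaraIdeal T | I.comap f ≤ p} (by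
    intro c hcs hc I₀ hI₀
    obtain ⟨U, hU⟩ := exists_mem_lev_iff_of_isChain hc hI₀
    refine ⟨U, fun H s hs => ?_, fun I hI H x hx => (hU H x).2 ⟨I, hI, hx⟩⟩
    obtain ⟨I, hI, hx⟩ := (hU H _).1 hs
    exact hcs hI H hx) _ (comap_sup_map_le hf hp hJ)
  refine ⟨q, isPrime_of_maximal hp hq.prop fun I h h' => hq.le_of_ge h' h,
    le_trans (J.le_sup_left _) hq₀, le_antisymm hq.prop ?_⟩
  exact map_le_iff_le_comap.1 (le_trans (J.le_sup_right _) hq₀)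

end TambaraIdeal

namespace NakaokaSpec

variable (f) in
/-- The continuous map of Nakaoka spectra given by inverse images of prime ideals. -/
def comap : C(NakaokaSpec T, NakaokaSpec S) where
  toFun q := ⟨q.ideal.comap f, q.isPrime.comap⟩
  continuous_toFun := by
    refine continuous_def.2 fun U hU => ?_
    obtain ⟨I, hI⟩ : Uᶜ ∈ Set.range zeroLocus := hU
    refine ⟨I.map f, ?_⟩
    rw [← Set.preimage_compl, ← hI]
    exact Set.ext fun q => TambaraIdeal.map_le_iff_le_comap

end NakaokaSpec

end LyingOver

theorem mainTheorem2 {G : Type u} [Group G] [Finite G]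
    {S : TambaraFunctor.{u, v} G} {T : TambaraFunctor.{u, w} G}
    (f : TambaraHom S T) (hf : f.LevelwiseIntegral) :
    f.GoingUp ∧
      ∃ φ : C(NakaokaSpec T, NakaokaSpec S),
        (∀ q : NakaokaSpec T, (φ q).ideal = q.ideal.comap f) ∧
        (f.LevelwiseInjective → Function.Surjective φ) ∧
        ((∀ (p : NakaokaSpec S) (H : Subgroup G),
            RingHom.ker (f.app (FinGSet.orbit H)) ≤ p.ideal.lev H) →
          Function.Surjective φ) := by
  have surj : (∀ (p : NakaokaSpec S) (H : Subgroup G),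
      RingHom.ker (f.app (FinGSet.orbit H)) ≤ p.ideal.lev H) →
      Function.Surjective (NakaokaSpec.comap f) := by
    intro h p
    obtain ⟨q, hq, -, hqp⟩ := TambaraIdeal.exists_isPrime_comap_eq hf
      -- The empty set generates the zero ideal, whose contraction is the kernel of f.
      (J := (MultiplicativeIdeal.empty T).gen) p.isPrime fun H s hs =>
        h p H (MultiplicativeIdeal.eq_zero_of_mem_gen_empty hs)
    exact ⟨⟨q, hq⟩, NakaokaSpec.ext hqp⟩
  refine ⟨fun p₀ p₁ _ hp₁ hlt q₀ _ hc => ?_, NakaokaSpec.comap f, fun _ => rfl, fun hinj =>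
    surj fun p H s hs => ?_, surj⟩
  · obtain ⟨q, hq, hle, hqp⟩ := TambaraIdeal.exists_isPrime_comap_eq hf (J := q₀) hp₁
      (hc.le.trans hlt.le)
    refine ⟨q, hq, lt_of_le_of_ne hle ?_, hqp⟩
    rintro rfl
    exact hlt.ne (hc.symm.trans hqp)
  · rw [RingHom.mem_ker] at hs
    have : s = 0 := hinj H (hs.trans (map_zero _).symm)
    rw [this]
    exact Ideal.zero_mem _
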